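/- Let $X$ be a smooth projective algebraic curve over an algebraically closed field $k$ of characteristic $0$, $F=k(X)$ its field of rational functions. For a point $P\in X$ let $F_P$ be the completion of $F$ at $P$, $v_P$ its normalised valuation, $\mathcal O_P$ its valuation ring and $\mathfrak p=\mathfrak p_P$ the maximal ideal. Let $\mathbb A_X=\prod'_P F_P$ be the ring of adeles, $\mathbb J_X=\mathbb A_X^*$ the group of ideles, $\mathcal O_X=\prod_P\mathcal O_P$, $\mathfrak P_X=\prod_P\mathfrak p_P$, and for $D\in\mathrm{Div}(X)$ let $\mathbb A_X(D)=\{x\in\mathbb A_X: v_P(x_P)\ge -v_P(D)\text{ for all }P\}$, where $v_P(D)$ is the coefficient of $P$ in $D$. For $a\in\mathbb J_X$ put $D_a=\sum_P v_P(a_P)P\in\mathrm{Div}(X)$. *Heisenberg algebra and Fock space.* $\mathfrak g_X=\mathbb A_X\oplus kC$ is the Lie algebra with $C$ central and $[x,y]=-\sum_{P}\mathrm{Res}_P(x_P\,dy_P)\,C$ for $x,y\in\mathbb A_X$. The Fock space $(\mathcal F_X,\rho)$ is the $\mathfrak g_X$-module induced from the one-dimensional module of $\mathcal O_X\oplus kC$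 on which $\mathcal O_X$ acts by $0$ and $C$ by $1$; that is, $\mathcal F_X=U\mathfrak g_X/I$, where $I$ is the left ideal generated by $\mathcal O_X$ and $C-1$. We write $\boldsymbol x=\rho(x)$ for $x\in\mathbb A_X$. *Heisenberg system.* The local tame symbol is $\tau_P(f,g)=(-1)^{mn}f^n/g^m \bmod\mathfrak p\in k^*$, $m=v_P(f)$, $n=v_P(g)$, and $\tau_X(a,b)=\prod_P\tau_P(a_P,b_P)$. The group $G_X=\mathbb J_X\times k^*$ has the law $(a,\alpha)(b,\beta)=(ab,\tau_X(a,b)^{-1}\alpha\beta)$. It acts on $\mathfrak g_X$ by $\mathrm{Ad}\,g\cdot(x+\gamma C)=x+\gamma C+\sum_P\mathrm{Res}_P(x_P\,d\log a_P)\,C$, $g=(a,\alpha)$. A representation of the global Heisenberg system $(G_X,\mathfrak g_X,\mathrm{Ad})$ in a $k$-vector space $V$ is a pair $(R,dR)$ of a representation $R$ of $G_X$ and a representation $dR$ of the Lie algebra $\mathfrak g_X$ in $V$ such that $dR(\mathrm{Ad}\,g\cdot\tilde x)=R(g)\,dR(\tilde x)\,R(g)^{-1}$ for all $g\in G_X$,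 $\tilde x\in\mathfrak g_X$, such that $R((1,\alpha))=\alpha I$ for $\alpha\in k^*$ and $dR(C)=I$, and such that both are continuous for the discrete topology of $V$: for every $v\in V$ there is a divisor $D$ with $R((a,1))v=v$ whenever $a-1,a^{-1}-1\in\mathbb A_X(D)$, and there is a divisor $D$ with $dR(x)v=0$ for all $x\in\mathbb A_X(D)$. *The induced pair.* Let $G_X^+=\prod_P\mathcal O_P^*\times k^*\subset G_X$. Every $g_+\in G_X^+$ can be written as $g_+=(\{\alpha_P\exp\varphi_P\}_P,\beta)$ with $\alpha_P,\beta\in k^*$ and $\varphi=\{\varphi_P\}_P\in\mathfrak P_X$; put $r_X(g_+)=\beta\exp\rho(\varphi)\in\mathrm{End}\,\mathcal F_X$. The space $\mathrm{Ind}_{G_X^+}^{G_X}\mathcal F_X$ consists of the functions $f:G_X\to\mathcal F_X$ with $f(gg_+)=r_X(g_+)^{-1}f(g)$ for $g\in G_X$, $g_+\in G_X^+$, whose support meets only finitely many cosets in $G_X/G_X^+\simeq\mathrm{Div}(X)$. Put $$(R_X(g)f)(h)=f(g^{-1}h),\qquad (dR_X(\tilde x)f)(g)=\rho(\mathrm{Ad}\,g^{-1}\cdot\tilde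 x)(f(g)),\qquad g,h\in G_X,\ \tilde x\in\mathfrak g_X .$$ *The extended charged Fock space.* Let, for every $P$, $F_P=\mathcal O_P\oplus F_P^-$ be a decomposition into $k$-subspaces, with $F_P^-$ isotropic for the form $(f,g)\mapsto-\mathrm{Res}_P(f\,dg)$, and for $f=f_++f_-\in F_P$ put $f(0)=f_+\bmod\mathfrak p\in k$. For $D=\sum_P n_PP$ and $x\in\mathbb A_X$ put $x(D)=\sum_P n_P\,x_P(0)$. Let $\tilde{\mathcal B}_X=k[\mathrm{Div}(X)]\otimes_k\mathcal F_X$, where $k[\mathrm{Div}(X)]$ is the group algebra with basis $e_D$, and write $e_D\odot v$ for $e_D\otimes v$. Uniformizers $t_P\in F_P$ are called adapted if $\mathrm{Res}_P(y\,d\log t_P)=0$ for all $y\in F_P^-$ and all $P$. **Theorem.** 1. Every $g_+\in G_X^+$ has the form above, $r_X$ is well defined, and it is a representation of $G_X^+$ in $\mathcal F_X$. 2. $R_X$ and $dR_X$ are well defined on $\mathrm{Ind}_{G_X^+}^{G_X}\mathcal F_X$, and $(R_X,dR_X)$ is a representation of the global Heisenberg system $(G_X,\mathfrak g_X,\mathrm{Ad})$.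 3. $\mathrm{Ind}_{G_X^+}^{G_X}\mathcal F_X\simeq\tilde{\mathcal B}_X$. More precisely, for all decompositions $F_P=\mathcal O_P\oplus F_P^-$ as above, adapted uniformizers exist, and for each choice $\{t_P\}$ of them there is a $k$-linear isomorphism $\Phi:\tilde{\mathcal B}_X\to\mathrm{Ind}_{G_X^+}^{G_X}\mathcal F_X$ such that $\Phi(e_D\odot v)$ is supported on the elements $(a,\alpha)$ with $D_a=D$ and takes the value $v$ at $(\{t_P^{v_P(D)}\}_P,1)$, and which carries the following operators on $\tilde{\mathcal B}_X$ into $dR_X$ and $R_X$: $$(x+\gamma C)\cdot(e_D\odot v)=-x(D)\,e_D\odot v+e_D\odot\rho(x+\gamma C)v,\qquad x\in\mathbb A_X,\ \gamma\in k,$$ $$(a,1)\cdot(e_D\odot v)=(-1)^{\sum_P v_P(D_a)v_P(D)}\prod_P\alpha_P^{-v_P(D_a)-2v_P(D)}\;e_{D+D_a}\odot\exp\rho(\varphi)\,v$$ for every idele $a=\{\alpha_Pt_P^{v_P(a_P)}\exp\varphi_P\}_P$ with $\alpha_P\in k^*$ and $\varphi=\{\varphi_P\}_P\in\mathfrak P_X$.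 -/

import Mathlib

open scoped WithZero RestrictedProduct
open IsDedekindDomain

/-- A complete discretely valued field `K` with residue field `k` embedded as constants -/
class CompleteClosedField (k K : Type*) [Field k] [Field K] [Algebra k K] [Valued K ℤᵐ⁰] :
    Prop where
  complete : CompleteSpace K
  val_algebraMap : ∀ a : k, a ≠ 0 → Valued.v (algebraMap k K a) = 1
  exists_residue : ∀ x : K, Valued.v x ≤ 1 → ∃ a : k, Valued.v (x - algebraMap k K a) < 1
  exists_uniformizer : ∃ t : K, Valued.v t = WithZero.exp (-1 : ℤ)

namespace CompleteClosedField
noncomputable section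

variable (k : Type*) {K : Type*} [Field k] [Field K] [Algebra k K] [Valued K ℤᵐ⁰]

open Classical in
/-- `x mod 𝔭` for `x ∈ 𝒪_K`; the value is `0` if `x ∉ 𝒪_K`. -/
def resid (x : K) : k :=
  if h : ∃ a : k, Valued.v (x - algebraMap k K a) < 1 then h.choose else 0

/-- The normalised valuation `K → ℤ` (with the value `0` at `0`). -/
def ord (x : K) : ℤ := -WithZero.log (Valued.v x)

variable (K) in
/-- The group `𝒪_K^*` of units of the valuation ring. -/
def unitGroup : Subgroup Kˣ where
  carrier := {u | Valued.v (u : K) = 1}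
  mul_mem' {a b} ha hb := by
    simp only [Set.mem_ofPred_eq, Units.val_mul, map_mul] at *
    rw [ha, hb, one_mul]
  one_mem' := by simp [Set.mem_ofPred_eq]
  inv_mem' {a} ha := by
    simp only [Set.mem_ofPred_eq, Units.val_inv_eq_inv_val, map_inv₀] at *
    rw [ha, inv_one]

theorem mem_unitGroup {u : Kˣ} : u ∈ unitGroup K ↔ Valued.v (u : K) = 1 := by
  change u ∈ {u : Kˣ | Valued.v (u : K) = 1} ↔ _
  rw [Set.mem_ofPred_eq]

/-- The exponential series `∑ φⁿ / n!`, summed in the topology of `K`. -/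
def expSeries (φ : K) : K := ∑' n : ℕ, (n.factorial : K)⁻¹ * φ ^ n

open Classical in
/-- The element `φ ∈ 𝔭` with `u = α exp φ`, `α ∈ k`, for a unit `u ∈ 𝒪_K^*`. -/
def expPart (u : K) : K :=
  if h : ∃ φ : K, Valued.v φ < 1 ∧ ∃ α : k, u = algebraMap k K α * expSeries φ then h.choose else 0

theorem val_expPart_lt (u : K) : Valued.v (expPart k u) < 1 := by
  rw [expPart]
  split_ifs with h
  · exact h.choose_spec.1
  · simp

variable [CompleteClosedField k K]

theorem val_algebraMap_le (a : k) : Valued.v (algebraMap k K a) ≤ 1 := by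
  by_cases h : a = 0
  · simp [h]
  · exact (val_algebraMap a h).le

theorem resid_eq {x : K} {a : k} (h : Valued.v (x - algebraMap k K a) < 1) : resid k x = a := by
  have hex : ∃ a : k, Valued.v (x - algebraMap k K a) < 1 := ⟨a, h⟩
  rw [resid, dif_pos hex]
  by_contra hne
  have h1 := hex.choose_spec
  set b := hex.choose
  have h2 := val_algebraMap (K := K) (b - a) (sub_ne_zero.2 hne)
  have h3 : algebraMap k K (b - a) = (x - algebraMap k K a) - (x - algebraMap k K b) := by
    rw [map_sub]; ring
  rw [h3] at h2
  have := Valuation.map_sub_lt (Valued.v : Valuation K ℤᵐ⁰) h h1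
  exact absurd h2 this.ne

variable {k} in
theorem resid_spec {x : K} (h : Valued.v x ≤ 1) :
    Valued.v (x - algebraMap k K (resid k x)) < 1 := by
  obtain ⟨a, ha⟩ := exists_residue (k := k) x h
  rwa [resid_eq k ha]

variable (K) in
/-- The valuation ring `𝒪_K`. -/
def integers : Subalgebra k K where
  carrier := {x | Valued.v x ≤ 1}
  mul_mem' {a b} ha hb := by
    simp only [Set.mem_ofPred_eq, map_mul] at *
    exact mul_le_one' ha hb
  add_mem' {a b} ha hb := by
    simp only [Set.mem_ofPred_eq] at *
    exact Valued.v.map_add_le ha hb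
  algebraMap_mem' a := by
    simp only [Set.mem_ofPred_eq]
    exact val_algebraMap_le k a

variable {k} in
theorem mem_integers {x : K} : x ∈ integers k K ↔ Valued.v x ≤ 1 := by
  change x ∈ {x : K | Valued.v x ≤ 1} ↔ _
  rw [Set.mem_ofPred_eq]

variable (K) in
/-- Reduction `𝒪_K → k` modulo the maximal ideal. -/
def residHom : integers k K →ₐ[k] k where
  toFun x := resid k (x : K)
  map_one' := resid_eq k (by simp)
  map_mul' x y := by
    apply resid_eq
    have hx := resid_spec (k := k) (mem_integers.1 x.2)
    have hy := resid_spec (k := k) (mem_integers.1 y.2)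
    have : (((x * y : integers k K) : K) - algebraMap k K (resid k (x : K) * resid k (y : K)))
      = (x - algebraMap k K (resid k (x : K))) * y
        + algebraMap k K (resid k (x : K)) * (y - algebraMap k K (resid k (y : K))) := by
      rw [Subalgebra.coe_mul, map_mul]; ring
    rw [this]
    apply Valuation.map_add_lt
    · rw [map_mul]
      exact lt_of_le_of_lt (mul_le_of_le_one_right' (mem_integers.1 y.2)) hx
    · rw [map_mul]
      exact lt_of_le_of_lt (mul_le_of_le_one_left' (val_algebraMap_le k _)) hy
  map_zero' := resid_eq k (by simp)
  map_add' x y := by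
    apply resid_eq
    have hx := resid_spec (k := k) (mem_integers.1 x.2)
    have hy := resid_spec (k := k) (mem_integers.1 y.2)
    have : (((x + y : integers k K) : K) - algebraMap k K (resid k (x : K) + resid k (y : K)))
      = (x - algebraMap k K (resid k (x : K))) + (y - algebraMap k K (resid k (y : K))) := by
      rw [Subalgebra.coe_add, map_add]; ring
    rw [this]
    exact Valuation.map_add_lt _ hx hy
  commutes' a := resid_eq k (by simp)

variable (K) in
/-- A chosen uniformizer of `K`. -/
def unif : K := (exists_uniformizer (k := k) (K := K)).choose

theorem v_unif : Valued.v (unif k K) = WithZero.exp (-1 : ℤ) :=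
  (exists_uniformizer (k := k) (K := K)).choose_spec

theorem unif_ne_zero : unif k K ≠ 0 := by
  intro h
  have := v_unif k (K := K)
  rw [h, map_zero] at this
  exact WithZero.exp_ne_zero this.symm

theorem v_le_unif {x : K} (h : Valued.v x < 1) : Valued.v (x / unif k K) ≤ 1 := by
  rw [map_div₀, v_unif]
  rw [div_le_one₀ (WithZero.exp_pos)]
  by_cases hx : Valued.v x = 0
  · rw [hx]; exact zero_le
  · rw [← WithZero.log_le_iff_le_exp hx]
    have := (WithZero.log_lt_iff_lt_exp (a := 0) hx).2 (by simpa using h)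
    lia

/-- The operator `x ↦ (x - x(0)) / t` on `𝒪_K`, which removes the constant term of the expansion
of `x` in powers of the uniformizer `t` and shifts the rest. -/
def shift (x : integers k K) : integers k K :=
  ⟨((x : K) - algebraMap k K (residHom k K x)) / unif k K, mem_integers.2 (v_le_unif k (resid_spec (mem_integers.1 x.2)))⟩

theorem shift_eq (x : integers k K) :
    (x : K) = algebraMap k K (residHom k K x) + unif k K * shift k x := by
  have := unif_ne_zero k (K := K)
  change _ = _ + unif k K * (((x : K) - algebraMap k K (residHom k K x)) / unif k K)
  field_simp; ring

theorem shift_unique {x y : integers k K} {a : k}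
    (h : (x : K) = algebraMap k K a + unif k K * y) : residHom k K x = a ∧ shift k x = y := by
  have ha : residHom k K x = a := by
    apply resid_eq
    rw [h]
    simp only [add_sub_cancel_left, map_mul, v_unif]
    refine lt_of_le_of_lt (mul_le_of_le_one_right' (mem_integers.1 y.2)) ?_
    rw [← WithZero.exp_zero]; exact WithZero.exp_lt_exp.2 (by norm_num)
  refine ⟨ha, ?_⟩
  have h2 := shift_eq k x
  rw [ha, h] at h2
  exact Subtype.ext (mul_left_cancel₀ (unif_ne_zero k) (add_left_cancel h2)).symm

/-- The `n`-th coefficient of the expansion `x = ∑ aₙ tⁿ` of `x ∈ 𝒪_K`. -/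
def coeffInt (n : ℕ) (x : integers k K) : k := residHom k K ((shift k)^[n] x)

theorem shift_add (x y : integers k K) : shift k (x + y) = shift k x + shift k y := by
  refine (shift_unique k (a := residHom k K x + residHom k K y) ?_).2
  rw [Subalgebra.coe_add, Subalgebra.coe_add, map_add]
  linear_combination shift_eq k x + shift_eq k y

theorem shift_mul (x y : integers k K) :
    shift k (x * y) = shift k x * y + residHom k K x • shift k y := by
  refine (shift_unique k (a := residHom k K x * residHom k K y) ?_).2
  have hx := shift_eq k x
  have hy := shift_eq k y
  rw [Subalgebra.coe_mul, Subalgebra.coe_add, Subalgebra.coe_mul, Subalgebra.coe_smul,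
    Algebra.smul_def, map_mul]
  generalize algebraMap k K (residHom k K x) = a at *
  generalize algebraMap k K (residHom k K y) = b at *
  generalize (shift k x : K) = s at *
  generalize (shift k y : K) = r at *
  linear_combination y * hx + a * hy

theorem shift_smul (a : k) (y : integers k K) : shift k (a • y) = a • shift k y := by
  refine (shift_unique k (a := a * residHom k K y) ?_).2
  have hy := shift_eq k y
  rw [Subalgebra.coe_smul, Subalgebra.coe_smul, Algebra.smul_def, Algebra.smul_def, map_mul]
  generalize algebraMap k K (residHom k K y) = b at *
  generalize (shift k y : K) = r at *
  rw [hy]; ring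

theorem shift_algebraMap (a : k) : shift k (algebraMap k (integers k K) a) = 0 := by
  refine (shift_unique k (a := a) ?_).2
  simp

theorem coeffInt_add (n : ℕ) (x y : integers k K) :
    coeffInt k n (x + y) = coeffInt k n x + coeffInt k n y := by
  unfold coeffInt
  induction n generalizing x y with
  | zero => simp
  | succ n ih => simp only [Function.iterate_succ_apply, shift_add, ih]

theorem coeffInt_smul (n : ℕ) (a : k) (x : integers k K) :
    coeffInt k n (a • x) = a * coeffInt k n x := by
  unfold coeffInt
  induction n generalizing x with
  | zero => simp
  | succ n ih => simp only [Function.iterate_succ_apply, shift_smul, ih]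

theorem coeffInt_succ (n : ℕ) (x : integers k K) :
    coeffInt k (n + 1) x = coeffInt k n (shift k x) := rfl

theorem coeffInt_mul (n : ℕ) (x y : integers k K) :
    coeffInt k n (x * y) =
      ∑ p ∈ Finset.HasAntidiagonal.antidiagonal n, coeffInt k p.1 x * coeffInt k p.2 y := by
  induction n generalizing x y with
  | zero => simp [coeffInt]
  | succ n ih =>
    rw [Finset.Nat.sum_antidiagonal_succ]
    simp only [coeffInt_succ, shift_mul, coeffInt_add, coeffInt_smul, ih]
    rw [add_comm]; rfl

theorem coeffInt_algebraMap (n : ℕ) (a : k) :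
    coeffInt k n (algebraMap k (integers k K) a) = if n = 0 then a else 0 := by
  cases n with
  | zero => simp [coeffInt]
  | succ n =>
    rw [coeffInt_succ, shift_algebraMap]
    have := coeffInt_smul k n 0 (0 : integers k K)
    simpa using this

variable (K) in
/-- The expansion `𝒪_K → k⟦X⟧` of integral elements in powers of the chosen uniformizer. -/
def expandInt : integers k K →ₐ[k] PowerSeries k where
  toFun x := PowerSeries.mk fun n => coeffInt k n x
  map_one' := by
    ext n
    have := coeffInt_algebraMap (K := K) k n 1
    rw [map_one] at this
    simp [this, PowerSeries.coeff_one]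
  map_mul' x y := by ext n; simp [coeffInt_mul, PowerSeries.coeff_mul]
  map_zero' := by
    ext n
    have := coeffInt_algebraMap (K := K) k n 0
    rw [map_zero] at this
    simp [this]
  map_add' x y := by ext n; simp [coeffInt_add]
  commutes' a := by
    ext n
    rw [PowerSeries.coeff_mk, coeffInt_algebraMap, PowerSeries.algebraMap_apply,
      Algebra.algebraMap_self, RingHom.id_apply, PowerSeries.coeff_C]

theorem val_lt_of_coeffInt_eq_zero (x : integers k K) (h : ∀ n, coeffInt k n x = 0) (n : ℕ) :
    Valued.v (x : K) ≤ WithZero.exp (-(n : ℤ)) := by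
  induction n generalizing x with
  | zero => simpa using mem_integers.1 x.2
  | succ n ih =>
    have h0 : residHom k K x = 0 := h 0
    rw [shift_eq k x, h0, map_zero, zero_add, map_mul, v_unif]
    have := ih (shift k x) fun m => h (m + 1)
    calc _ ≤ WithZero.exp (-1 : ℤ) * WithZero.exp (-(n : ℤ)) := by gcongr
      _ = _ := by rw [← WithZero.exp_add]; congr 1; push_cast; ring

theorem expandInt_injective : Function.Injective (expandInt k K) := by
  rw [injective_iff_map_eq_zero]
  intro x hx
  have h : ∀ n, coeffInt k n x = 0 := fun n => by
    have := congrArg (PowerSeries.coeff n) hx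
    simpa [expandInt] using this
  by_contra hne
  have hne' : Valued.v (x : K) ≠ 0 := by
    simpa using hne
  have h1 := val_lt_of_coeffInt_eq_zero k x h (Int.toNat (1 - WithZero.log (Valued.v (x : K))))
  rw [← WithZero.log_le_iff_le_exp hne'] at h1
  have := Int.self_le_toNat (1 - WithZero.log (Valued.v (x : K)))
  lia

instance : IsFractionRing (integers k K) K := by
  refine IsFractionRing.of_field (integers k K) K fun z => ?_
  by_cases hz : Valued.v z ≤ 1
  · exact ⟨⟨z, mem_integers.2 hz⟩, 1, by simp⟩
  · refine ⟨1, ⟨z⁻¹, mem_integers.2 ?_⟩, ?_⟩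
    · rw [map_inv₀]
      exact inv_le_one_of_one_le₀ (not_le.1 hz).le
    · change z = algebraMap _ K 1 / z⁻¹
      simp

variable (K) in
/-- The Laurent expansion `K → k((X))` in powers of the chosen uniformizer: the unique extension of
`expandInt` to a homomorphism of fields. -/
def expand : K →+* LaurentSeries k :=
  IsFractionRing.lift (A := integers k K)
    (g := (algebraMap (PowerSeries k) (LaurentSeries k)).comp (expandInt k K : _ →+* _))
    ((IsFractionRing.injective (PowerSeries k) (LaurentSeries k)).comp (expandInt_injective k))

theorem expand_int (x : integers k K) :
    expand k K (x : K) = algebraMap (PowerSeries k) (LaurentSeries k) (expandInt k K x) :=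
  IsFractionRing.lift_algebraMap _ x

theorem expand_algebraMap (a : k) : expand k K (algebraMap k K a) = HahnSeries.C a := by
  have := expand_int k (algebraMap k (integers k K) a)
  rw [AlgHom.commutes] at this
  refine this.trans ?_
  rw [PowerSeries.algebraMap_apply, Algebra.algebraMap_self, RingHom.id_apply]
  exact HahnSeries.ofPowerSeries_C a

theorem expand_smul (a : k) (x : K) : expand k K (a • x) = a • expand k K x := by
  rw [Algebra.smul_def, map_mul, expand_algebraMap, HahnSeries.C_mul_eq_smul]

/-- `Res (f dg)`: the coefficient of `t⁻¹` in `f · dg/dt`, where `t` is a uniformizer. -/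
def res (f g : K) : k :=
  (expand k K f * LaurentSeries.derivative k (expand k K g)).coeff (-1)

/-- `Res (f dlog a) = Res (f a⁻¹ da)`. -/
def resDlog (f a : K) : k := res k (f * a⁻¹) a

theorem res_add_left (f₁ f₂ g : K) : res k (f₁ + f₂) g = res k f₁ g + res k f₂ g := by
  simp [res, add_mul]

theorem res_add_right (f g₁ g₂ : K) : res k f (g₁ + g₂) = res k f g₁ + res k f g₂ := by
  simp only [res, map_add, mul_add, HahnSeries.coeff_add]

theorem res_smul_left (a : k) (f g : K) : res k (a • f) g = a * res k f g := by
  rw [res, res, expand_smul, ← HahnSeries.C_mul_eq_smul, mul_assoc, HahnSeries.C_mul_eq_smul,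
    HahnSeries.coeff_smul, smul_eq_mul]

theorem res_smul_right (a : k) (f g : K) : res k f (a • g) = a * res k f g := by
  rw [res, res, expand_smul, map_smul, ← HahnSeries.C_mul_eq_smul, mul_left_comm,
    HahnSeries.C_mul_eq_smul, HahnSeries.coeff_smul, smul_eq_mul]

theorem res_int {f g : K} (hf : Valued.v f ≤ 1) (hg : Valued.v g ≤ 1) : res k f g = 0 := by
  have h1 := expand_int k ⟨f, mem_integers.2 hf⟩
  have h2 := expand_int k ⟨g, mem_integers.2 hg⟩
  simp only at h1 h2
  have neg : ∀ (p : PowerSeries k) (n : ℤ), n < 0 →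
      (algebraMap (PowerSeries k) (LaurentSeries k) p).coeff n = 0 := by
    intro p n hn
    exact (PowerSeries.coeff_coe p n).trans (if_pos hn)
  rw [res, h1, h2, HahnSeries.coeff_mul]
  refine Finset.sum_eq_zero fun p hp => ?_
  rw [Finset.mem_antidiagonal] at hp
  by_cases h : p.1 < 0
  · rw [neg _ _ h, zero_mul]
  · have : p.2 + 1 ≤ 0 := by lia
    rw [LaurentSeries.derivative_apply, LaurentSeries.hasseDeriv_coeff]
    rcases this.lt_or_eq with h' | h'
    · rw [Nat.cast_one, neg _ _ h', smul_zero, mul_zero]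
    · simp [h']

theorem coeff_mul_derivative (f : LaurentSeries k) :
    2 * (f * LaurentSeries.derivative k f).coeff (-1) = 0 := by
  classical
  set g : ℤ → k := fun i => f.coeff i * (LaurentSeries.derivative k f).coeff (-1 - i) with hg
  have hg' : ∀ i, g (-i) = -g i := by
    intro i
    have h1 : (-1 : ℤ) - i + 1 = -i := by ring
    have h2 : (-1 : ℤ) - -i + 1 = i := by ring
    simp only [hg, LaurentSeries.derivative_apply, LaurentSeries.hasseDeriv_coeff, Nat.cast_one,
      h1, h2, Ring.choose_one_right, zsmul_eq_mul, Int.cast_neg]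
    ring
  rw [HahnSeries.coeff_mul]
  set A := Finset.antidiagonal f.isPWO_support
    (LaurentSeries.derivative k f).isPWO_support (-1) with hA
  set B := A.image Prod.fst with hB
  set T := B ∪ B.image Neg.neg with hT
  have e1 : ∑ p ∈ A, f.coeff p.1 * (LaurentSeries.derivative k f).coeff p.2 = ∑ i ∈ B, g i := by
    rw [hB, Finset.sum_image]
    · refine Finset.sum_congr rfl fun p hp => ?_
      rw [hA, Finset.mem_antidiagonal] at hp
      simp only [hg]
      rw [show -1 - p.1 = p.2 by lia]
    · intro p hp q hq hpq
      rw [Finset.mem_coe, hA, Finset.mem_antidiagonal] at hp hq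
      exact Prod.ext hpq (by lia)
  have e2 : ∑ i ∈ B, g i = ∑ i ∈ T, g i := by
    refine Finset.sum_subset Finset.subset_union_left fun i _ hi => ?_
    by_contra hne
    apply hi
    rw [hB, Finset.mem_image]
    refine ⟨(i, -1 - i), ?_, rfl⟩
    rw [hA, Finset.mem_antidiagonal]
    exact ⟨left_ne_zero_of_mul hne, right_ne_zero_of_mul hne, by simp⟩
  have e3 : ∑ i ∈ T, g i = ∑ i ∈ T, g (-i) := by
    refine Finset.sum_nbij' Neg.neg Neg.neg ?_ ?_ ?_ ?_ ?_
    · intro i hi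
      simp only [hT, Finset.mem_union, Finset.mem_image] at hi ⊢
      rcases hi with h | ⟨j, hj, rfl⟩
      · exact Or.inr ⟨i, h, rfl⟩
      · exact Or.inl (by simpa using hj)
    · intro i hi
      simp only [hT, Finset.mem_union, Finset.mem_image] at hi ⊢
      rcases hi with h | ⟨j, hj, rfl⟩
      · exact Or.inr ⟨i, h, rfl⟩
      · exact Or.inl (by simpa using hj)
    · intro i _; simp
    · intro i _; simp
    · intro i _; simp
  rw [e1, e2]
  simp only [hg', Finset.sum_neg_distrib] at e3
  linear_combination e3

theorem res_self [CharZero k] (f : K) : res k f f = 0 := by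
  exact (mul_eq_zero.1 (coeff_mul_derivative k (expand k K f))).resolve_left two_ne_zero

variable (K) in
/-- Reduction of units `𝒪_K^* → k^*`. -/
def residUnits : unitGroup K →* kˣ :=
  MonoidHom.toHomUnits
    { toFun := fun u => residHom k K ⟨(u : Kˣ), mem_integers.2 (mem_unitGroup.1 u.2).le⟩
      map_one' := map_one (residHom k K)
      map_mul' := fun u w => map_mul (residHom k K)
        ⟨(u : Kˣ), mem_integers.2 (mem_unitGroup.1 u.2).le⟩
        ⟨(w : Kˣ), mem_integers.2 (mem_unitGroup.1 w.2).le⟩ }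

theorem val_eq_exp (u : Kˣ) : Valued.v (u : K) = WithZero.exp (-ord (u : K)) := by
  rw [ord, neg_neg, WithZero.exp_log]
  simp

theorem ord_mul (u w : Kˣ) : ord ((u * w : Kˣ) : K) = ord (u : K) + ord (w : K) := by
  simp only [ord, Units.val_mul, map_mul]
  rw [WithZero.log_mul (by simp) (by simp)]
  ring

/-- `(-1)^{mn} fⁿ / gᵐ` with `m = v(f)` and `n = v(g)`. -/
def tameUnit (f g : Kˣ) : Kˣ :=
  (-1) ^ (ord (f : K) * ord (g : K)) * (f ^ ord (g : K) / g ^ ord (f : K))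

theorem tameUnit_mem (f g : Kˣ) : tameUnit f g ∈ unitGroup K := by
  refine mul_mem (zpow_mem (mem_unitGroup.2 (by simp [Valuation.map_neg])) _) ?_
  rw [mem_unitGroup, Units.val_div_eq_div_val, map_div₀, Units.val_zpow_eq_zpow_val,
    Units.val_zpow_eq_zpow_val, map_zpow₀, map_zpow₀, val_eq_exp, val_eq_exp,
    ← WithZero.exp_zsmul, ← WithZero.exp_zsmul, smul_eq_mul, smul_eq_mul, mul_neg, mul_neg,
    mul_comm, div_self WithZero.exp_ne_zero]

/-- The tame symbol `τ(f, g) = (-1)^{mn} fⁿ / gᵐ mod 𝔭 ∈ k^*`. -/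
def tame (f g : Kˣ) : kˣ := residUnits k K ⟨tameUnit f g, tameUnit_mem f g⟩

theorem tame_mul_left (f₁ f₂ g : Kˣ) : tame k (f₁ * f₂) g = tame k f₁ g * tame k f₂ g := by
  rw [tame, tame, tame, ← map_mul]
  congr 1
  apply Subtype.ext
  change tameUnit _ _ = tameUnit _ _ * tameUnit _ _
  simp only [tameUnit, ord_mul, add_mul, zpow_add, mul_zpow]
  simp only [div_eq_mul_inv, mul_inv]
  ac_rfl

theorem tame_mul_right (f g₁ g₂ : Kˣ) : tame k f (g₁ * g₂) = tame k f g₁ * tame k f g₂ := by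
  rw [tame, tame, tame, ← map_mul]
  congr 1
  apply Subtype.ext
  change tameUnit _ _ = tameUnit _ _ * tameUnit _ _
  simp only [tameUnit, ord_mul, mul_add, zpow_add, mul_zpow]
  simp only [div_eq_mul_inv, mul_inv]
  ac_rfl

theorem tame_unit {f g : Kˣ} (hf : f ∈ unitGroup K) (hg : g ∈ unitGroup K) : tame k f g = 1 := by
  have h : ∀ {u : Kˣ}, u ∈ unitGroup K → ord (u : K) = 0 := fun hu => by
    rw [ord, mem_unitGroup.1 hu, WithZero.log_one, neg_zero]
  rw [tame, ← map_one (residUnits k K)]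
  congr 1
  apply Subtype.ext
  change tameUnit _ _ = 1
  simp [tameUnit, h hf, h hg]

variable (K) in
/-- A decomposition `K = 𝒪_K ⊕ K₋` into isotropic subspaces for the form `c(f, g) = -Res (f dg)`
(the subspace `𝒪_K` always is isotropic). -/
structure Splitting where
  /-- The subspace `K₋`. -/
  neg : Submodule k K
  isCompl : IsCompl (Subalgebra.toSubmodule (integers k K)) neg
  isotropic : ∀ f ∈ neg, ∀ g ∈ neg, res k f g = 0

variable {k} in
/-- The constant term `f(0) = f₊ mod 𝔭` of `f = f₊ + f₋`. -/
def Splitting.constTerm (S : Splitting k K) (f : K) : k :=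
  resid k ((Subalgebra.toSubmodule (integers k K)).projectionOnto S.neg S.isCompl f : K)

end
end CompleteClosedField

open CompleteClosedField

/-- `F` is the field of rational functions of an algebraic curve over the algebraically closed
field `k`: it is a finitely generated extension of `k` of transcendence degree one. -/
class IsCurveFunctionField (k F : Type*) [Field k] [Field F] [Algebra k F] : Prop where
  fg : (⊤ : IntermediateField k F).FG
  trdeg_eq_one : Algebra.trdeg k F = 1

/-- The points of the smooth projective curve `X` with function field `F`: the discrete valuation
rings of `F` that contain `k`. -/
structure CurvePoint (k F : Type*) [Field k] [Field F] [Algebra k F] where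
  /-- The local ring `O_P ⊂ F`. -/
  ring : ValuationSubring F
  algebraMap_mem : ∀ a : k, algebraMap k F a ∈ ring
  isDVR : IsDiscreteValuationRing ring

namespace CurvePoint
noncomputable section

variable {k F : Type*} [Field k] [Field F] [Algebra k F]

instance (P : CurvePoint k F) : IsDiscreteValuationRing P.ring := P.isDVR

/-- The local field `F_P`: the completion of `F` at the discrete valuation `v_P`. -/
abbrev LocalField (P : CurvePoint k F) : Type _ :=
  (IsDiscreteValuationRing.maximalIdeal P.ring).adicCompletion F

theorem aeval_ne_zero_and_inv_mem [IsAlgClosed k] (P : CurvePoint k F) {x : F}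
    (hx : ∀ a : k, x - algebraMap k F a ≠ 0 ∧ (x - algebraMap k F a)⁻¹ ∈ P.ring)
    (p : Polynomial k) (hp : p ≠ 0) :
    Polynomial.aeval x p ≠ 0 ∧ (Polynomial.aeval x p)⁻¹ ∈ P.ring := by
  rw [(IsAlgClosed.splits p).eq_prod_roots]
  rw [map_mul, mul_inv, Polynomial.aeval_C, ← map_inv₀]
  have key : Polynomial.aeval x (p.roots.map fun a => Polynomial.X - Polynomial.C a).prod ≠ 0 ∧
      (Polynomial.aeval x (p.roots.map fun a => Polynomial.X - Polynomial.C a).prod)⁻¹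
        ∈ P.ring := by
    generalize p.roots = s
    induction s using Multiset.induction_on with
    | empty => simp
    | cons a s ih =>
      rw [Multiset.map_cons, Multiset.prod_cons, map_mul, mul_inv]
      exact ⟨mul_ne_zero (by simpa using (hx a).1) ih.1, mul_mem (by simpa using (hx a).2) ih.2⟩
  refine ⟨mul_ne_zero ?_ key.1, mul_mem (P.algebraMap_mem _) key.2⟩
  simpa using hp

theorem valuation_le_one (P : CurvePoint k F) {x : F} (hx : x ∈ P.ring) :
    (IsDiscreteValuationRing.maximalIdeal P.ring).valuation F x ≤ 1 :=
  HeightOneSpectrum.valuation_le_one _ (⟨x, hx⟩ : P.ring)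

theorem mem_ring (P : CurvePoint k F) {x : F}
    (hx : (IsDiscreteValuationRing.maximalIdeal P.ring).valuation F x ≤ 1) : x ∈ P.ring := by
  obtain ⟨a, rfl⟩ := IsDiscreteValuationRing.exists_lift_of_le_one hx
  exact a.2

theorem exists_residue_ring [IsAlgClosed k] [IsCurveFunctionField k F] (P : CurvePoint k F)
    (x : F) (hx : x ∈ P.ring) : ∃ a : k,
      (IsDiscreteValuationRing.maximalIdeal P.ring).valuation F (x - algebraMap k F a) < 1 := by
  by_contra! hcon
  have hx' : ∀ a : k, x - algebraMap k F a ≠ 0 ∧ (x - algebraMap k F a)⁻¹ ∈ P.ring := by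
    intro a
    refine ⟨fun h => ?_, P.mem_ring ?_⟩
    · have := hcon a
      rw [h, map_zero] at this
      exact absurd this (by simp)
    · rw [map_inv₀]
      exact inv_le_one_of_one_le₀ (hcon a)
  have hind : AlgebraicIndependent k (fun _ : Unit => x) := by
    rw [algebraicIndependent_unique_type_iff, transcendental_iff_injective,
      injective_iff_map_eq_zero]
    intro p hp
    by_contra hne
    exact (P.aeval_ne_zero_and_inv_mem hx' p hne).1 hp
  have hbasis : IsTranscendenceBasis k (fun _ : Unit => x) :=
    hind.isTranscendenceBasis_of_lift_trdeg_le_of_finite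
      (by simp [IsCurveFunctionField.trdeg_eq_one])
  have halg := hbasis.isAlgebraic
  rw [Set.range_const] at halg
  set A := Algebra.adjoin k {x} with hA
  have hAx : ∀ a : A, ∃ q : Polynomial k, Polynomial.aeval x q = (a : F) := by
    intro a
    have := SetLike.le_def.1 (hA.le.trans (Algebra.adjoin_singleton_eq_range_aeval k x).le) a.2
    exact this
  have hAring : ∀ a : A, (a : F) ∈ P.ring := by
    intro a
    obtain ⟨q, hq⟩ := hAx a
    rw [← hq, Polynomial.aeval_eq_sum_range]
    refine sum_mem fun i _ => ?_
    rw [Algebra.smul_def]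
    exact mul_mem (P.algebraMap_mem _) (pow_mem hx i)
  have hall : ∀ f : F, f ∈ P.ring := by
    intro f
    obtain ⟨p, hp, hpf⟩ := halg.isAlgebraic f
    have hint := isIntegral_leadingCoeff_smul p f hpf
    obtain ⟨q, hq⟩ := hAx p.leadingCoeff
    have hq0 : q ≠ 0 := by
      rintro rfl
      rw [map_zero] at hq
      exact hp (Polynomial.leadingCoeff_eq_zero.1 (Subtype.ext hq.symm))
    obtain ⟨h1, h2⟩ := P.aeval_ne_zero_and_inv_mem hx' q hq0
    let φ : A →+* P.ring := (algebraMap A F).codRestrict P.ring.toSubring hAring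
    have hint2 : IsIntegral P.ring (p.leadingCoeff • f) := by
      obtain ⟨r, hr, hr0⟩ := hint
      refine ⟨r.map φ, hr.map φ, ?_⟩
      rw [Polynomial.eval₂_map]
      exact hr0
    obtain ⟨y, hy⟩ := IsIntegrallyClosed.isIntegral_iff.1 hint2
    have : f = (Polynomial.aeval x q)⁻¹ * (y : F) := by
      have hy' : (y : F) = p.leadingCoeff • f := hy
      rw [hy', Algebra.smul_def]
      change f = _ * ((p.leadingCoeff : F) * f)
      rw [← hq, inv_mul_cancel_left₀ h1]
    rw [this]
    exact mul_mem h2 y.2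
  obtain ⟨π, hπ⟩ := (IsDiscreteValuationRing.maximalIdeal P.ring).valuation_exists_uniformizer F
  have := P.valuation_le_one (hall π⁻¹)
  rw [map_inv₀, hπ] at this
  exact absurd this (by decide)

instance [IsAlgClosed k] [IsCurveFunctionField k F] (P : CurvePoint k F) :
    CompleteClosedField k P.LocalField where
  complete := inferInstance
  val_algebraMap a ha := by
    change Valued.v ((algebraMap k F a : F) : P.LocalField) = 1
    rw [HeightOneSpectrum.valuedAdicCompletion_eq_valuation']
    apply le_antisymm (P.valuation_le_one (P.algebraMap_mem a))
    have := P.valuation_le_one (P.algebraMap_mem a⁻¹)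
    rw [map_inv₀, map_inv₀] at this
    exact (inv_le_one₀ (by simpa [zero_lt_iff] using ha)).1 this
  exists_residue x hx := by
    obtain ⟨f, hf⟩ : ∃ f : F, Valued.v (x - (f : P.LocalField)) < 1 := by
      have hopen : IsOpen ((fun y : P.LocalField => x - y) ⁻¹' {z | Valued.v.restrict z < 1}) :=
        (Valued.isOpen_ball _ _).preimage (continuous_const.sub continuous_id)
      obtain ⟨f, hf⟩ := (HeightOneSpectrum.denseRange_algebraMap F
        (IsDiscreteValuationRing.maximalIdeal P.ring)).exists_mem_open hopen
          ⟨x, by simp⟩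
      refine ⟨f, ?_⟩
      have hf' : Valued.v.restrict (x - (f : P.LocalField)) < 1 := hf
      rwa [Valuation.restrict_lt_one_iff] at hf'
    have hf1 : (IsDiscreteValuationRing.maximalIdeal P.ring).valuation F f ≤ 1 := by
      rw [← HeightOneSpectrum.valuedAdicCompletion_eq_valuation']
      have : (f : P.LocalField) = x - (x - f) := by ring
      rw [this]
      exact Valuation.map_sub_le _ hx hf.le
    obtain ⟨a, ha⟩ := P.exists_residue_ring f (P.mem_ring hf1)
    refine ⟨a, ?_⟩
    have : x - algebraMap k P.LocalField a = (x - (f : P.LocalField))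
        + ((f - algebraMap k F a : F) : P.LocalField) := by
      change x - algebraMap F P.LocalField (algebraMap k F a) =
        (x - algebraMap F P.LocalField f) + algebraMap F P.LocalField (f - algebraMap k F a)
      rw [map_sub]; ring
    rw [this]
    refine Valuation.map_add_lt _ hf ?_
    rwa [HeightOneSpectrum.valuedAdicCompletion_eq_valuation']
  exists_uniformizer := by
    obtain ⟨π, hπ⟩ :=
      (IsDiscreteValuationRing.maximalIdeal P.ring).valuation_exists_uniformizer F
    exact ⟨(π : P.LocalField), by rw [HeightOneSpectrum.valuedAdicCompletion_eq_valuation', hπ]⟩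

end
end CurvePoint

noncomputable section GlobalTheory

open CompleteClosedField

variable (k F : Type*) [Field k] [IsAlgClosed k] [Field F] [Algebra k F] [IsCurveFunctionField k F]

/-- The ring of adeles `𝔸_X`: the restricted product of the `F_P` with respect to the `𝒪_P`. -/
abbrev Adele : Type _ := Πʳ P : CurvePoint k F, [P.LocalField, integers k P.LocalField]

/-- The group of ideles `𝕁_X`. -/
abbrev Idele : Type _ := (Adele k F)ˣ

/-- The group of divisors `Div(X)`. -/
abbrev CurveDivisor : Type _ := CurvePoint k F →₀ ℤ

variable {k F}

/-- The component `a_P ∈ F_P^*` of an idele. -/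
def Idele.comp (P : CurvePoint k F) : Idele k F →* P.LocalFieldˣ :=
  Units.map (RestrictedProduct.evalMonoidHom _ P)

theorem Idele.finite_not_unit (a : Idele k F) :
    {P | Idele.comp P a ∉ unitGroup P.LocalField}.Finite := by
  have h1 := (a : Adele k F).2
  have h2 := ((a⁻¹ : Idele k F) : Adele k F).2
  have := h1.and h2
  rw [Filter.eventually_cofinite] at this
  refine this.subset fun P hP => ?_
  intro h
  refine hP (mem_unitGroup.2 (le_antisymm (mem_integers.1 h.1) ?_))
  have h4 : Valued.v (((Idele.comp P a)⁻¹ : P.LocalFieldˣ) : P.LocalField) ≤ 1 := by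
    rw [← map_inv]; exact mem_integers.1 h.2
  rw [Units.val_inv_eq_inv_val, map_inv₀] at h4
  exact (inv_le_one₀ (by simp [zero_lt_iff])).1 h4

/-- The divisor `D_a = ∑ v_P(a_P) P` of an idele. -/
def Idele.div (a : Idele k F) : CurveDivisor k F :=
  Finsupp.ofSupportFinite (fun P => ord (Idele.comp P a : P.LocalField)) <| by
    refine (Idele.finite_not_unit a).subset fun P hP => ?_
    by_contra h
    simp only [Set.mem_ofPred_eq, not_not] at h
    exact hP (by simp [ord, mem_unitGroup.1 h])

/-- The subspace `𝔸_X(D) = {x | v_P(x_P) ≥ -v_P(D) for all P}`. -/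
def adeleSub (D : CurveDivisor k F) : Set (Adele k F) :=
  {x | ∀ P, Valued.v (x P) ≤ WithZero.exp (D P)}

variable (k F) in
/-- `𝒪_X = ∏ 𝒪_P`. -/
def integralAdeles : Set (Adele k F) := {x | ∀ P, Valued.v (x P) ≤ 1}

variable (k F) in
/-- `𝔓_X = ∏ 𝔭`. -/
def maximalAdeles : Set (Adele k F) := {x | ∀ P, Valued.v (x P) < 1}

theorem maximalAdeles_subset : maximalAdeles k F ⊆ integralAdeles k F := fun _ h P => (h P).le

theorem finite_res (x y : Adele k F) : {P | res k (x P) (y P) ≠ 0}.Finite := by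
  have := x.2.and y.2
  rw [Filter.eventually_cofinite] at this
  refine this.subset fun P hP h => hP ?_
  exact res_int k (mem_integers.1 h.1) (mem_integers.1 h.2)

/-- The form `c_X(x, y) = -∑ Res_P (x_P dy_P)`. -/
def cocycle (x y : Adele k F) : k := -∑ᶠ P, res k (x P) (y P)

theorem cocycle_add_left (x x' y : Adele k F) :
    cocycle (x + x') y = cocycle x y + cocycle x' y := by
  have h := finsum_add_distrib (finite_res x y) (finite_res x' y)
  simp only [cocycle, RestrictedProduct.add_apply, res_add_left]
  rw [h]; ring

theorem cocycle_add_right (x y y' : Adele k F) :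
    cocycle x (y + y') = cocycle x y + cocycle x y' := by
  have h := finsum_add_distrib (finite_res x y) (finite_res x y')
  simp only [cocycle, RestrictedProduct.add_apply, res_add_right]
  rw [h]; ring

theorem cocycle_smul_right (a : k) (x y : Adele k F) : cocycle x (a • y) = a * cocycle x y := by
  have h := smul_finsum' a (finite_res x y)
  simp only [smul_eq_mul] at h
  simp only [cocycle, RestrictedProduct.smul_apply, res_smul_right]
  rw [← h, mul_neg]

theorem cocycle_self [CharZero k] (x : Adele k F) : cocycle x x = 0 := by
  simp [cocycle, res_self]

theorem cocycle_zero_left (y : Adele k F) : cocycle 0 y = 0 := by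
  simpa using cocycle_add_left 0 0 y

theorem cocycle_zero_right (x : Adele k F) : cocycle x 0 = 0 := by
  simpa using cocycle_add_right x 0 0

theorem cocycle_skew [CharZero k] (x y : Adele k F) : cocycle y x = -cocycle x y := by
  have := cocycle_self (x + y)
  rw [cocycle_add_left, cocycle_add_right, cocycle_add_right, cocycle_self, cocycle_self] at this
  linear_combination this

theorem cocycle_integral {x y : Adele k F} (hx : x ∈ integralAdeles k F)
    (hy : y ∈ integralAdeles k F) : cocycle x y = 0 := by
  have h : ∀ P, res k (x P) (y P) = 0 := fun P => res_int k (hx P) (hy P)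
  simp [cocycle, h]

/-- `∑ Res_P (x_P dlog a_P)` for an adele `x` and an idele `a`. -/
def resLog (x : Adele k F) (a : Idele k F) : k :=
  ∑ᶠ P, resDlog k (x P) (Idele.comp P a : P.LocalField)

/-- The global tame symbol `τ_X(a, b) = ∏ τ_P(a_P, b_P)`. -/
def tameX (a b : Idele k F) : kˣ := ∏ᶠ P, tame k (Idele.comp P a) (Idele.comp P b)

theorem finite_tame (a b : Idele k F) :
    (Function.mulSupport fun P => tame k (Idele.comp P a) (Idele.comp P b)).Finite := by
  refine ((Idele.finite_not_unit a).union (Idele.finite_not_unit b)).subset fun P hP => ?_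
  by_contra h
  simp only [Set.mem_union, Set.mem_ofPred_eq, not_or, not_not] at h
  exact hP (tame_unit k h.1 h.2)

theorem tameX_mul_left (a a' b : Idele k F) : tameX (a * a') b = tameX a b * tameX a' b := by
  simp only [tameX, map_mul, tame_mul_left]
  exact finprod_mul_distrib (finite_tame a b) (finite_tame a' b)

theorem tameX_mul_right (a b b' : Idele k F) : tameX a (b * b') = tameX a b * tameX a b' := by
  simp only [tameX, map_mul, tame_mul_right]
  exact finprod_mul_distrib (finite_tame a b) (finite_tame a b')

variable (k F) in
/-- The global Heisenberg Lie algebra `𝔤_X = 𝔸_X ⊕ k C`; the pair `(x, γ)` is `x + γ C`. -/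
def HeisenbergAlgebra : Type _ := Adele k F × k

namespace HeisenbergAlgebra

instance : AddCommGroup (HeisenbergAlgebra k F) := inferInstanceAs (AddCommGroup (Adele k F × k))
instance : Module k (HeisenbergAlgebra k F) := inferInstanceAs (Module k (Adele k F × k))

/-- The element `x + γ C`. -/
def mk (x : Adele k F) (γ : k) : HeisenbergAlgebra k F := (x, γ)

variable (k F) in
/-- The central element `C`. -/
def C : HeisenbergAlgebra k F := mk 0 1

variable [CharZero k]

instance : LieRing (HeisenbergAlgebra k F) where
  bracket x y := mk 0 (cocycle x.1 y.1)
  add_lie x y z := Prod.ext (add_zero (0 : Adele k F)).symm (cocycle_add_left _ _ _)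
  lie_add x y z := Prod.ext (add_zero (0 : Adele k F)).symm (cocycle_add_right _ _ _)
  lie_self x := Prod.ext rfl (cocycle_self _)
  leibniz_lie x y z := by
    refine Prod.ext (add_zero (0 : Adele k F)).symm ?_
    change cocycle x.1 0 = cocycle 0 z.1 + cocycle y.1 0
    simp only [cocycle_zero_left, cocycle_zero_right, add_zero]

instance : LieAlgebra k (HeisenbergAlgebra k F) where
  lie_smul a _ _ := Prod.ext (smul_zero a).symm (cocycle_smul_right a _ _)

end HeisenbergAlgebra

open HeisenbergAlgebra

section Fock

attribute [local instance 100] LieRing.ofAssociativeRing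

variable (k F) [CharZero k]

/-- The left ideal of `U𝔤_X` generated by `𝒪_X ⊕ 0` and `C - 1`. -/
def fockIdeal : Submodule (UniversalEnvelopingAlgebra k (HeisenbergAlgebra k F))
    (UniversalEnvelopingAlgebra k (HeisenbergAlgebra k F)) :=
  Submodule.span _
    ({u | ∃ x ∈ integralAdeles k F, u = UniversalEnvelopingAlgebra.ι k (mk x 0)} ∪
      {UniversalEnvelopingAlgebra.ι k (C k F) - 1})

/-- The global Fock space `ℱ_X`: the `𝔤_X`-module induced from the one-dimensional module of
`𝔤_X⁺ = 𝒪_X ⊕ k C` on which `𝒪_X` acts by `0` and `C` by `1`. -/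
def FockSpace : Type _ :=
  UniversalEnvelopingAlgebra k (HeisenbergAlgebra k F) ⧸ fockIdeal k F

instance : AddCommGroup (FockSpace k F) :=
  inferInstanceAs (AddCommGroup (_ ⧸ fockIdeal k F))
instance : Module (UniversalEnvelopingAlgebra k (HeisenbergAlgebra k F)) (FockSpace k F) :=
  inferInstanceAs (Module _ (_ ⧸ fockIdeal k F))
instance : Module k (FockSpace k F) :=
  inferInstanceAs (Module k (_ ⧸ fockIdeal k F))
instance : IsScalarTower k (UniversalEnvelopingAlgebra k (HeisenbergAlgebra k F))
    (FockSpace k F) :=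
  inferInstanceAs (IsScalarTower k _ (_ ⧸ fockIdeal k F))

/-- The representation `ρ` of `𝔤_X` in `ℱ_X`. -/
def rho : HeisenbergAlgebra k F →ₗ[k] Module.End k (FockSpace k F) :=
  (Algebra.lsmul k k (FockSpace k F)).toLinearMap ∘ₗ
    (UniversalEnvelopingAlgebra.ι k : HeisenbergAlgebra k F →ₗ⁅k⁆ _).toLinearMap

/-- The vacuum vector `1_X`. -/
def vacuum : FockSpace k F := Submodule.Quotient.mk 1

variable {k F}

theorem rho_apply (x : HeisenbergAlgebra k F) (v : FockSpace k F) :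
    rho k F x v = UniversalEnvelopingAlgebra.ι k x • v := rfl

theorem lie_eq (x y : HeisenbergAlgebra k F) : ⁅x, y⁆ = cocycle x.1 y.1 • C k F := by
  refine Prod.ext (smul_zero (A := Adele k F) _).symm ?_
  exact (mul_one _).symm

theorem rho_vacuum {x : Adele k F} (hx : x ∈ integralAdeles k F) :
    rho k F (mk x 0) (vacuum k F) = 0 := by
  rw [rho_apply, vacuum]
  refine (Submodule.Quotient.mk_eq_zero _).2 ?_
  change _ * 1 ∈ _
  rw [mul_one]
  exact Submodule.subset_span (Or.inl ⟨x, hx, rfl⟩)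

/-- The vacuum generates the Fock space. -/
theorem fock_induction {p : Submodule k (FockSpace k F)} (h1 : vacuum k F ∈ p)
    (hstep : ∀ (x : HeisenbergAlgebra k F), ∀ v ∈ p, rho k F x v ∈ p) (v : FockSpace k F) :
    v ∈ p := by
  have key : ∀ t : TensorAlgebra k (HeisenbergAlgebra k F), ∀ v ∈ p,
      UniversalEnvelopingAlgebra.mkAlgHom k (HeisenbergAlgebra k F) t • v ∈ p := by
    intro t
    induction t using TensorAlgebra.induction with
    | algebraMap r =>
      intro v hv
      rw [AlgHom.commutes, algebraMap_smul]
      exact p.smul_mem r hv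
    | ι x => exact fun v hv => hstep x v hv
    | mul a b ha hb =>
      intro v hv
      rw [map_mul, mul_smul]
      exact ha _ (hb _ hv)
    | add a b ha hb =>
      intro v hv
      rw [map_add, add_smul]
      exact p.add_mem (ha _ hv) (hb _ hv)
  obtain ⟨u, rfl⟩ := Submodule.Quotient.mk_surjective _ v
  obtain ⟨t, rfl⟩ : ∃ t, UniversalEnvelopingAlgebra.mkAlgHom k (HeisenbergAlgebra k F) t = u :=
    RingCon.mkₐ_surjective _ u
  have h := key t _ h1
  generalize UniversalEnvelopingAlgebra.mkAlgHom k (HeisenbergAlgebra k F) t = w at h ⊢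
  have e : (Submodule.Quotient.mk w : FockSpace k F) = w • vacuum k F :=
    congrArg (Submodule.Quotient.mk (p := fockIdeal k F)) (mul_one w).symm
  exact e ▸ h

theorem rho_lie (x y : HeisenbergAlgebra k F) (v : FockSpace k F) :
    rho k F ⁅x, y⁆ v = rho k F x (rho k F y v) - rho k F y (rho k F x v) := by
  simp only [rho_apply, LieHom.map_lie, LieRing.of_associative_ring_bracket, sub_smul, mul_smul]

theorem rho_C (v : FockSpace k F) : rho k F (C k F) v = v := by
  refine fock_induction (p := LinearMap.eqLocus (rho k F (C k F)) LinearMap.id) ?_ ?_ v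
  · change rho k F (C k F) (vacuum k F) = vacuum k F
    rw [rho_apply, vacuum]
    refine (Submodule.Quotient.eq _).2 ?_
    change _ * 1 - 1 ∈ _
    rw [mul_one]
    exact Submodule.subset_span (Or.inr rfl)
  · intro x v hv
    have hv' : rho k F (C k F) v = v := hv
    change rho k F (C k F) (rho k F x v) = rho k F x v
    have h := rho_lie (C k F) x v
    have h0 : ⁅C k F, x⁆ = 0 := by
      rw [lie_eq]
      change cocycle 0 x.1 • _ = _
      rw [cocycle_zero_left, zero_smul]
    rw [h0, hv', map_zero, LinearMap.zero_apply] at h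
    exact (sub_eq_zero.1 h.symm)

theorem rho_comm (x y : HeisenbergAlgebra k F) (v : FockSpace k F) :
    rho k F x (rho k F y v) = rho k F y (rho k F x v) + cocycle x.1 y.1 • v := by
  have h := rho_lie x y v
  rw [lie_eq, map_smul, LinearMap.smul_apply, rho_C] at h
  rw [h]; abel

theorem rho_locally_nilpotent {φ : Adele k F} (hφ : φ ∈ integralAdeles k F)
    (v : FockSpace k F) : ∃ n : ℕ, (rho k F (mk φ 0) ^ n) v = 0 := by
  set T := rho k F (mk φ 0) with hT
  let p : Submodule k (FockSpace k F) :=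
    { carrier := {v | ∃ n : ℕ, (T ^ n) v = 0}
      zero_mem' := ⟨0, by simp⟩
      add_mem' := by
        rintro v w ⟨n, hn⟩ ⟨m, hm⟩
        refine ⟨n + m, ?_⟩
        rw [map_add]
        nth_rewrite 1 [add_comm n m]
        rw [pow_add, pow_add, Module.End.mul_apply, Module.End.mul_apply, hn, hm, map_zero,
          map_zero, add_zero]
      smul_mem' := by
        rintro a v ⟨n, hn⟩
        exact ⟨n, by rw [map_smul, hn, smul_zero]⟩ }
  refine fock_induction (p := p) ⟨1, ?_⟩ ?_ v
  · rw [pow_one]; exact rho_vacuum hφ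
  · rintro x v ⟨n, hn⟩
    refine ⟨n + 1, ?_⟩
    induction n generalizing v with
    | zero =>
      have hv : v = 0 := by simpa using hn
      rw [hv, map_zero, map_zero]
    | succ n ih =>
      rw [pow_succ, Module.End.mul_apply, hT, rho_comm, ← hT, map_add, map_smul, hn, smul_zero,
        add_zero]
      exact ih (T v) (by rw [← Module.End.mul_apply, ← pow_succ, hn])

/-- The exponential `∑ Tⁿ / n!` of a locally nilpotent endomorphism. -/
def expEnd {V : Type*} [AddCommGroup V] [Module k V] (T : Module.End k V)
    (hT : ∀ v, ∃ n : ℕ, (T ^ n) v = 0) : Module.End k V :=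
  have hfin : ∀ v, {n : ℕ | ((n.factorial : k)⁻¹ • (T ^ n) v) ≠ 0}.Finite := fun v => by
    obtain ⟨N, hN⟩ := hT v
    refine (Set.finite_lt_nat N).subset fun n hn => ?_
    by_contra h
    refine hn ?_
    simp only [Set.mem_ofPred_eq, not_lt] at h
    rw [← Nat.sub_add_cancel h, pow_add, Module.End.mul_apply, hN, map_zero, smul_zero]
  { toFun := fun v => ∑ᶠ n : ℕ, (n.factorial : k)⁻¹ • (T ^ n) v
    map_add' := fun v w => by
      rw [← finsum_add_distrib (hfin v) (hfin w)]
      simp only [map_add, smul_add]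
    map_smul' := fun a v => by
      rw [RingHom.id_apply, smul_finsum' a (hfin v)]
      simp only [map_smul, smul_comm a] }

variable (k F) in
/-- `exp ρ(φ)` for `φ ∈ 𝔓_X`. -/
def expRho (φ : maximalAdeles k F) : Module.End k (FockSpace k F) :=
  expEnd (rho k F (mk φ 0)) (rho_locally_nilpotent (maximalAdeles_subset φ.2))

end Fock

section Group

variable (k F) in
/-- The global group `G_X = 𝕁_X × k^*`, the central extension of `𝕁_X` by the tame symbol. -/
@[ext]
structure GlobalGroup where
  idele : Idele k F
  scalar : kˣ

namespace GlobalGroup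

instance : Group (GlobalGroup k F) :=
  letI : Mul (GlobalGroup k F) :=
    ⟨fun a b => ⟨a.idele * b.idele, (tameX a.idele b.idele)⁻¹ * a.scalar * b.scalar⟩⟩
  letI : One (GlobalGroup k F) := ⟨⟨1, 1⟩⟩
  letI : Inv (GlobalGroup k F) :=
    ⟨fun a => ⟨a.idele⁻¹, tameX a.idele⁻¹ a.idele * a.scalar⁻¹⟩⟩
  Group.ofLeftAxioms
    (fun a b c => GlobalGroup.ext (mul_assoc _ _ _) (by
      change (tameX (a.idele * b.idele) c.idele)⁻¹ *
          ((tameX a.idele b.idele)⁻¹ * a.scalar * b.scalar) * c.scalar =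
        (tameX a.idele (b.idele * c.idele))⁻¹ * a.scalar *
          ((tameX b.idele c.idele)⁻¹ * b.scalar * c.scalar)
      rw [tameX_mul_left, tameX_mul_right, mul_inv, mul_inv]
      generalize (tameX a.idele b.idele)⁻¹ = p
      generalize (tameX a.idele c.idele)⁻¹ = q
      generalize (tameX b.idele c.idele)⁻¹ = r
      ac_rfl))
    (fun a => GlobalGroup.ext (one_mul _) (by
      change (tameX 1 a.idele)⁻¹ * 1 * a.scalar = a.scalar
      have h := tameX_mul_left 1 1 a.idele
      rw [one_mul, left_eq_mul] at h
      rw [h]; simp))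
    (fun a => GlobalGroup.ext (inv_mul_cancel _) (by
      change (tameX a.idele⁻¹ a.idele)⁻¹ * (tameX a.idele⁻¹ a.idele * a.scalar⁻¹) * a.scalar = 1
      simp))

theorem mul_def (a b : GlobalGroup k F) :
    a * b = ⟨a.idele * b.idele, (tameX a.idele b.idele)⁻¹ * a.scalar * b.scalar⟩ := rfl

theorem one_def : (1 : GlobalGroup k F) = ⟨1, 1⟩ := rfl

theorem inv_def (a : GlobalGroup k F) :
    a⁻¹ = ⟨a.idele⁻¹, tameX a.idele⁻¹ a.idele * a.scalar⁻¹⟩ := rfl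

end GlobalGroup

variable (k F) in
/-- The subgroup `G_X⁺ = ∏ 𝒪_P^* × k^*`. -/
def plusGroup : Subgroup (GlobalGroup k F) where
  carrier := {g | ∀ P, Idele.comp P g.idele ∈ unitGroup P.LocalField}
  mul_mem' {a b} ha hb := by
    simp only [Set.mem_ofPred_eq] at *
    intro P
    rw [GlobalGroup.mul_def, map_mul]
    exact mul_mem (ha P) (hb P)
  one_mem' := by
    simp only [Set.mem_ofPred_eq]
    intro P
    rw [GlobalGroup.one_def, map_one]
    exact one_mem _
  inv_mem' {a} ha := by
    simp only [Set.mem_ofPred_eq] at *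
    intro P
    rw [GlobalGroup.inv_def, map_inv]
    exact inv_mem (ha P)

/-- The adjoint action `Ad g · (x + γ C) = x + γ C + ∑ Res_P (x_P dlog a_P) C`, `g = (a, α)`. -/
def Ad (g : GlobalGroup k F) (x : HeisenbergAlgebra k F) : HeisenbergAlgebra k F :=
  x + resLog x.1 g.idele • C k F

variable [CharZero k]

/-- The adele `φ ∈ 𝔓_X` attached to `g = ({α_P exp φ_P}, β) ∈ G_X⁺`. -/
def logAdele (g : plusGroup k F) : maximalAdeles k F :=
  ⟨⟨fun P => expPart k (Idele.comp P g.1.idele : P.LocalField),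
    .of_forall fun _ => mem_integers.2 (val_expPart_lt k _).le⟩, fun _ => val_expPart_lt k _⟩

/-- The representation `r_X(g) = β exp ρ(φ)` of `G_X⁺` in `ℱ_X`, for
`g = ({α_P exp φ_P}, β) ∈ G_X⁺`. -/
def rX (g : plusGroup k F) : Module.End k (FockSpace k F) :=
  (g.1.scalar : k) • expRho k F (logAdele g)

variable (k F) in
/-- The space of the induced `G_X`-module: the functions `f : G_X → ℱ_X` with
`f (g g₊) = r_X(g₊)⁻¹ f (g)` for `g₊ ∈ G_X⁺` that are supported on finitely many cosets in
`G_X / G_X⁺`. -/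
def inducedModule : Submodule k (GlobalGroup k F → FockSpace k F) where
  carrier := {f | (∀ (g : GlobalGroup k F) (h : plusGroup k F), f (g * h) = rX h⁻¹ (f g)) ∧
    ((QuotientGroup.mk : _ → GlobalGroup k F ⧸ plusGroup k F) '' Function.support f).Finite}
  add_mem' {f₁ f₂} h₁ h₂ := by
    simp only [Set.mem_ofPred_eq] at *
    refine ⟨fun g h => ?_, ?_⟩
    · rw [Pi.add_apply, Pi.add_apply, h₁.1, h₂.1, map_add]
    · refine (h₁.2.union h₂.2).subset ?_
      rw [← Set.image_union]
      exact Set.image_mono (Function.support_add f₁ f₂)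
  zero_mem' := by
    simp only [Set.mem_ofPred_eq]
    refine ⟨fun g h => ?_, ?_⟩
    · rw [Pi.zero_apply, Pi.zero_apply, map_zero]
    · simp
  smul_mem' a {f} hf := by
    simp only [Set.mem_ofPred_eq] at *
    refine ⟨fun g h => ?_, ?_⟩
    · rw [Pi.smul_apply, Pi.smul_apply, hf.1, map_smul]
    · exact hf.2.subset (Set.image_mono (Function.support_const_smul_subset a f))

/-- A representation of the global Heisenberg system `(G_X, 𝔤_X, Ad)` in a (discrete) `k`-vector
space `V`: a representation `R` of `G_X` and a representation `dR` of `𝔤_X` intertwined by `Ad`.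
As for all modules over these central extensions, the centres `k^*` and `k C` act by scalars and
the actions are continuous. -/
structure IsHeisenbergSystemRep {V : Type*} [AddCommGroup V] [Module k V]
    (R : GlobalGroup k F →* Module.End k V) (dR : HeisenbergAlgebra k F →ₗ[k] Module.End k V) :
    Prop where
  lie : ∀ x y, dR ⁅x, y⁆ = dR x * dR y - dR y * dR x
  compat : ∀ g x, dR (Ad g x) = R g * dR x * R g⁻¹
  central_group : ∀ α : kˣ, R ⟨1, α⟩ = (α : k) • 1
  central_alg : dR (C k F) = 1
  continuous_group : ∀ v : V, ∃ D : CurveDivisor k F, ∀ a : Idele k F,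
    (a : Adele k F) - 1 ∈ adeleSub D → ((a⁻¹ : Idele k F) : Adele k F) - 1 ∈ adeleSub D →
      R ⟨a, 1⟩ v = v
  continuous_alg : ∀ v : V, ∃ D : CurveDivisor k F, ∀ x ∈ adeleSub D, dR (mk x 0) v = 0

/-- `x(D) = ∑ n_P x_P(0)` for `D = ∑ n_P P`, where the constant terms `x_P(0)` are taken with
respect to decompositions `F_P = 𝒪_P ⊕ F_P⁻`. -/
def evalDivisor (S : ∀ P : CurvePoint k F, Splitting k P.LocalField) (x : Adele k F)
    (D : CurveDivisor k F) : k :=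
  D.sum fun P n => (n : k) * (S P).constTerm (x P)

variable (k F) in
/-- The extended charged Fock space `ℬ̃_X = k[Div X] ⊙ ℱ_X`. -/
abbrev ChargedFockSpace : Type _ :=
  TensorProduct k (AddMonoidAlgebra k (CurveDivisor k F)) (FockSpace k F)

/-- The vector `e_D ⊙ v` of `ℬ̃_X`. -/
def chargedVec (D : CurveDivisor k F) (v : FockSpace k F) : ChargedFockSpace k F :=
  TensorProduct.tmul k (AddMonoidAlgebra.single D 1) v

/-- The `t_P` are uniformizers of the `F_P` for which the expansions in powers of `t_P` of the
elements of `F_P⁻` have no constant term: `Res (y dt_P / t_P) = 0` for `y ∈ F_P⁻`. -/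
structure IsAdapted (S : ∀ P : CurvePoint k F, Splitting k P.LocalField)
    (t : ∀ P : CurvePoint k F, P.LocalField) : Prop where
  uniformizer : ∀ P, Valued.v (t P) = WithZero.exp (-1 : ℤ)
  const_zero : ∀ P, ∀ y ∈ (S P).neg, resDlog k y (t P) = 0

end Group
end GlobalTheory

/-!
The pair `(R_X, dR_X)` is an induced representation, and everything reduces to statements about the
local fields `F_P ≃ k((t))` and to the commutation relations in the Fock space.

*Local fields.* In characteristic `0` the exponential series converges on `𝔭`, is additive to
multiplicative (`expSeries_add`) and satisfies `v(exp φ - exp ψ) = v(φ - ψ)` (`val_expSeries_sub`).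
Being an isometry, it maps `𝔭` bijectively onto `1 + 𝔭`, by successive approximation
(`exists_expSeries_eq`), so that every unit is uniquely a constant times an exponential.
The formal derivative of Laurent series is a derivation (`derivative_mul`), and
`res_eq_zero_of_val` bounds the contribution of remainders to residues; hence
`Res (f dlog exp φ) = Res (f dφ)` (`resDlog_expSeries`).

*The representation of `G_X⁺`.* On integral adeles the cocycle vanishes, so that the operators
`ρ(φ)`, `φ ∈ 𝔓_X`, commute and `exp ρ(φ)` is multiplicative in `φ` (`rX_mul`). From
`[ρ(φ), ρ(x)] = c(φ, x)` one gets `exp ρ(φ) ρ(x) = (ρ(x) + c(φ, x)) exp ρ(φ)`, which together with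
`resDlog_expSeries` is the relation `r_X(g) ρ(x) = ρ(Ad g · x) r_X(g)` (`rX_rho`). This makes
`dR_X` well defined on the induced module.

*Continuity.* An element of the induced module is determined by its values at finitely many points
of `G_X`. For each of these, the ideles close to `1` have trivial tame symbol with the point, hence
commute with it, and their logarithms annihilate the value there because `ρ` is continuous
(`exists_divisor_forall_rho_eq_zero`).

*The charged Fock space.* The elements `({t_P ^ v_P(D)}, 1)` represent the cosets of `G_X⁺`, so that
evaluation at them identifies the induced module with the finitely supported functions
`Div(X) → ℱ_X` (`finsuppEquivInduced`). The formula for `𝔤_X` then says `Res (x dlog t) = x(0)`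
for adapted `t` (`Splitting.resDlog_eq_constTerm`), and the formula for `G_X` is a computation with
the tame symbol (`tameX_powIdele`). Adapted uniformizers exist (`Splitting.exists_adapted`) because
every linear form on `K / 𝒪` is `y ↦ Res (y dφ)` for some `φ ∈ 𝔭`.
-/

/-! ### The exponential in a complete local field -/

namespace CompleteClosedField
noncomputable section LocalExp

open Filter Topology

variable (k : Type*) {K : Type*} [Field k] [Field K] [Algebra k K] [Valued K ℤᵐ⁰]

theorem val_le_exp_neg_one {x : K} (h : Valued.v x < 1) :
    Valued.v x ≤ WithZero.exp (-1 : ℤ) := by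
  by_cases hx : Valued.v x = 0
  · rw [hx]; exact zero_le
  · rw [← WithZero.log_le_iff_le_exp hx]
    have := (WithZero.log_lt_iff_lt_exp (a := 0) hx).2 (by simpa using h)
    lia

theorem exp_neg_one_lt_one : WithZero.exp (-1 : ℤ) < 1 := by
  rw [← WithZero.exp_zero]; exact WithZero.exp_lt_exp.2 (by norm_num)

theorem val_pow_le {x : K} (h : Valued.v x < 1) (n : ℕ) :
    Valued.v (x ^ n) ≤ WithZero.exp (-(n : ℤ)) := by
  rw [map_pow]
  calc _ ≤ WithZero.exp (-1 : ℤ) ^ n := by gcongr; exact val_le_exp_neg_one h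
    _ = _ := by rw [← WithZero.exp_nsmul]; simp

theorem eq_zero_of_val_le {x : K} (h : ∀ n : ℕ, Valued.v x ≤ WithZero.exp (-(n : ℤ))) :
    x = 0 := by
  by_contra hne
  have hne' : Valued.v x ≠ 0 := by simpa using hne
  have h1 := h (Int.toNat (1 - WithZero.log (Valued.v x)))
  rw [← WithZero.log_le_iff_le_exp hne'] at h1
  lia

theorem tendsto_zero_of_val_le {ι : Type*} {l : Filter ι} {u : ι → K}
    (h : ∀ n : ℕ, ∀ᶠ i in l, Valued.v (u i) ≤ WithZero.exp (-(n : ℤ))) :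
    Tendsto u l (𝓝 0) := by
  refine tendsto_def.2 fun s hs => ?_
  obtain ⟨γ, hγ⟩ := Valued.mem_nhds_zero.1 hs
  set c : ℤᵐ⁰ := MonoidWithZeroHom.ValueGroup₀.embedding γ.1 with hc
  have hc0 : c ≠ 0 := by simp [hc]
  filter_upwards [h (Int.toNat (1 - WithZero.log c))] with i hi
  apply hγ
  simp only [Set.mem_ofPred_eq]
  rw [Valuation.restrict_lt_iff_lt_embedding]
  refine hi.trans_lt ?_
  rw [← WithZero.lt_log_iff_exp_lt hc0]
  lia

variable (K) in
theorem nonarchimedeanRing_of_valued : NonarchimedeanRing K where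
  is_nonarchimedean U hU := by
    obtain ⟨γ, hγ⟩ := Valued.mem_nhds_zero.1 hU
    exact ⟨⟨Valuation.ltAddSubgroup Valued.v.restrict γ, Valued.isOpen_ball K γ.1⟩, hγ⟩

variable [CompleteClosedField k K]
include k

theorem isClosed_val_le (n : ℤ) : IsClosed {x : K | Valued.v x ≤ WithZero.exp n} := by
  have h : WithZero.exp n = Valued.v (unif k K ^ (-n)) := by
    rw [map_zpow₀, v_unif, ← WithZero.exp_zsmul]; simp
  rw [h]
  have h' : {x : K | Valued.v x ≤ Valued.v (unif k K ^ (-n))} =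
      {x : K | Valued.v.restrict x ≤ Valued.v.restrict (unif k K ^ (-n))} :=
    Set.ext fun x => by simp only [Set.mem_ofPred_eq, Valuation.restrict_le_iff]
  rw [h']
  exact Valued.isClosed_closedBall _ _

theorem val_hasSum_le {f : ℕ → K} {s : K} (hf : HasSum f s) {n : ℤ}
    (h : ∀ i, Valued.v (f i) ≤ WithZero.exp n) : Valued.v s ≤ WithZero.exp n := by
  refine (isClosed_val_le k (K := K) n).mem_of_tendsto hf (.of_forall fun A => ?_)
  exact Valuation.map_sum_le _ fun i _ => h i

theorem summable_of_val_le {f : ℕ → K}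
    (h : ∀ n, Valued.v (f n) ≤ WithZero.exp (-(n : ℤ))) : Summable f := by
  have := CompleteClosedField.complete (k := k) (K := K)
  have := nonarchimedeanRing_of_valued K
  refine NonarchimedeanAddGroup.summable_of_tendsto_cofinite_zero ?_
  rw [Nat.cofinite_eq_atTop]
  refine tendsto_zero_of_val_le fun n => ?_
  filter_upwards [eventually_ge_atTop n] with m hm
  exact (h m).trans (WithZero.exp_le_exp.2 (by lia))

theorem val_tsum_sub_le {f : ℕ → K}
    (h : ∀ n, Valued.v (f n) ≤ WithZero.exp (-(n : ℤ))) (N : ℕ) :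
    Valued.v ((∑' n, f n) - ∑ n ∈ Finset.range N, f n) ≤ WithZero.exp (-(N : ℤ)) := by
  have hs := (hasSum_nat_add_iff' N).2 (summable_of_val_le k h).hasSum
  exact val_hasSum_le k hs fun i => (h _).trans (WithZero.exp_le_exp.2 (by push_cast; lia))

variable [CharZero k]

omit [Valued K ℤᵐ⁰] [CompleteClosedField k K] in
variable (K) in
theorem charZero_of_const : CharZero K :=
  charZero_of_injective_algebraMap (algebraMap k K).injective

theorem val_natCast {n : ℕ} (hn : n ≠ 0) : Valued.v (n : K) = 1 := by
  rw [← map_natCast (algebraMap k K)]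
  exact val_algebraMap _ (Nat.cast_ne_zero.2 hn)

theorem val_expTerm_le {φ : K} (hφ : Valued.v φ < 1) (n : ℕ) :
    Valued.v ((n.factorial : K)⁻¹ * φ ^ n) ≤ WithZero.exp (-(n : ℤ)) := by
  rw [map_mul, map_inv₀, val_natCast k (Nat.factorial_ne_zero n), inv_one, one_mul]
  exact val_pow_le hφ n

theorem summable_expTerm {φ : K} (hφ : Valued.v φ < 1) :
    Summable fun n : ℕ => (n.factorial : K)⁻¹ * φ ^ n :=
  summable_of_val_le k (val_expTerm_le k hφ)

theorem val_expSeries_sub_le {φ : K} (hφ : Valued.v φ < 1) (N : ℕ) :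
    Valued.v (expSeries φ - ∑ n ∈ Finset.range N, (n.factorial : K)⁻¹ * φ ^ n) ≤
      WithZero.exp (-(N : ℤ)) :=
  val_tsum_sub_le k (val_expTerm_le k hφ) N

omit k [Algebra k K] [CompleteClosedField k K] [CharZero k] in
theorem expSeries_zero : expSeries (0 : K) = 1 := by
  rw [expSeries, tsum_eq_single 0]
  · simp
  · intro n hn; simp [hn]

omit k [Algebra k K] [CompleteClosedField k K] [CharZero k] [Valued K ℤᵐ⁰] in
theorem inv_factorial_mul_choose [CharZero K] {p : ℕ × ℕ} {n : ℕ} (hp : p.1 + p.2 = n) (φ ψ : K) :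
    (n.factorial : K)⁻¹ * n.choose p.1 • (φ ^ p.1 * ψ ^ p.2) =
      ((p.1.factorial : K)⁻¹ * φ ^ p.1) * ((p.2.factorial : K)⁻¹ * ψ ^ p.2) := by
  have h3 := Nat.choose_mul_factorial_mul_factorial (n := n) (k := p.1) (by lia)
  rw [show n - p.1 = p.2 by lia] at h3
  have h4 : ((n.choose p.1 : ℕ) : K) * p.1.factorial * p.2.factorial = n.factorial := by
    exact_mod_cast h3
  have a1 : (p.1.factorial : K) ≠ 0 := Nat.cast_ne_zero.2 (Nat.factorial_ne_zero _)
  have a2 : (p.2.factorial : K) ≠ 0 := Nat.cast_ne_zero.2 (Nat.factorial_ne_zero _)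
  have a3 : (n.factorial : K) ≠ 0 := Nat.cast_ne_zero.2 (Nat.factorial_ne_zero _)
  have h5 : (n.factorial : K)⁻¹ * (n.choose p.1 : K) =
      (p.1.factorial : K)⁻¹ * (p.2.factorial : K)⁻¹ := by
    field_simp
    linear_combination h4
  rw [nsmul_eq_mul]
  linear_combination φ ^ p.1 * ψ ^ p.2 * h5

theorem expSeries_add {φ ψ : K} (hφ : Valued.v φ < 1) (hψ : Valued.v ψ < 1) :
    expSeries (φ + ψ) = expSeries φ * expSeries ψ := by
  have := charZero_of_const k K
  have := nonarchimedeanRing_of_valued K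
  have h1 := summable_expTerm k hφ
  have h2 := summable_expTerm k hψ
  have h3 : Summable fun x : ℕ × ℕ => ((x.1.factorial : K)⁻¹ * φ ^ x.1) *
      ((x.2.factorial : K)⁻¹ * ψ ^ x.2) := 
    Summable.mul_of_nonarchimedean (f := fun n : ℕ => (n.factorial : K)⁻¹ * φ ^ n)
      (g := fun n : ℕ => (n.factorial : K)⁻¹ * ψ ^ n) h1 h2
  have h4 := h1.tsum_mul_tsum_eq_tsum_sum_antidiagonal h2 h3
  refine Eq.trans ?_ h4.symm
  refine tsum_congr fun n => ?_
  rw [Commute.add_pow' (mul_comm φ ψ), Finset.mul_sum]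
  refine Finset.sum_congr rfl fun p hp => ?_
  rw [Finset.HasAntidiagonal.mem_antidiagonal] at hp
  exact inv_factorial_mul_choose hp φ ψ

/-- The linear term dominates: `exp φ - 1` has the same valuation as `φ`. -/
theorem val_expSeries_sub_one {φ : K} (hφ : Valued.v φ < 1) :
    Valued.v (expSeries φ - 1) = Valued.v φ := by
  by_cases h0 : φ = 0
  · rw [h0, expSeries_zero]; simp
  have hs := (hasSum_nat_add_iff' 2).2 (summable_expTerm k hφ).hasSum
  have hs' := hs.mul_left (φ⁻¹ ^ 2)
  have h2 := val_hasSum_le k hs' (n := 0) (fun i => by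
    have : φ⁻¹ ^ 2 * (((i + 2).factorial : K)⁻¹ * φ ^ (i + 2)) =
      ((i + 2).factorial : K)⁻¹ * φ ^ i := by
      rw [pow_add]; field_simp
    rw [this, map_mul, map_inv₀, val_natCast k (Nat.factorial_ne_zero _), inv_one, one_mul, map_pow]
    exact pow_le_one₀ zero_le hφ.le)
  set y := φ⁻¹ ^ 2 * ((∑' n : ℕ, (n.factorial : K)⁻¹ * φ ^ n) -
    ∑ i ∈ Finset.range 2, (i.factorial : K)⁻¹ * φ ^ i) with hy
  have h3 : expSeries φ - 1 = φ + φ * (φ * y) := by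
    simp only [hy, expSeries, Finset.sum_range_succ]
    field_simp
    simp
    ring
  rw [h3]
  apply Valuation.map_add_eq_of_lt_left
  rw [map_mul, map_mul]
  have hpos : 0 < Valued.v φ := by simpa [zero_lt_iff] using h0
  refine mul_lt_of_lt_one_right hpos ?_
  exact (mul_le_of_le_one_right' (by simpa using h2)).trans_lt hφ

theorem val_expSeries {φ : K} (hφ : Valued.v φ < 1) : Valued.v (expSeries φ) = 1 := by
  have h := val_expSeries_sub_one k hφ
  have : expSeries φ = 1 + (expSeries φ - 1) := by ring
  rw [this, Valuation.map_add_eq_of_lt_left, map_one]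
  rw [h, map_one]; exact hφ

theorem expSeries_ne_zero {φ : K} (hφ : Valued.v φ < 1) : expSeries φ ≠ 0 := by
  intro h
  have := val_expSeries k hφ
  rw [h, map_zero] at this
  exact zero_ne_one this

theorem expSeries_neg_mul {φ : K} (hφ : Valued.v φ < 1) :
    expSeries (-φ) * expSeries φ = 1 := by
  rw [← expSeries_add k (by rwa [Valuation.map_neg]) hφ, neg_add_cancel, expSeries_zero]

theorem expSeries_neg {φ : K} (hφ : Valued.v φ < 1) :
    expSeries (-φ) = (expSeries φ)⁻¹ :=
  eq_inv_of_mul_eq_one_left (expSeries_neg_mul k hφ)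

theorem expSeries_sub {φ ψ : K} (hφ : Valued.v φ < 1) (hψ : Valued.v ψ < 1) :
    expSeries (φ - ψ) = expSeries φ / expSeries ψ := by
  rw [sub_eq_add_neg, expSeries_add k hφ (by rwa [Valuation.map_neg]), expSeries_neg k hψ,
    div_eq_mul_inv]

theorem val_expSeries_sub {φ ψ : K} (hφ : Valued.v φ < 1) (hψ : Valued.v ψ < 1) :
    Valued.v (expSeries φ - expSeries ψ) = Valued.v (φ - ψ) := by
  have hψ' := expSeries_ne_zero k hψ
  have h : expSeries φ - expSeries ψ = (expSeries (φ - ψ) - 1) * expSeries ψ := by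
    rw [expSeries_sub k hφ hψ]; field_simp
  rw [h, map_mul, val_expSeries k hψ, mul_one,
    val_expSeries_sub_one k (Valuation.map_sub_lt _ hφ hψ)]

theorem resid_const_mul_expSeries {γ : k} {χ : K} (hχ : Valued.v χ < 1) :
    resid k (algebraMap k K γ * expSeries χ) = γ := by
  apply resid_eq
  rw [show algebraMap k K γ * expSeries χ - algebraMap k K γ =
    algebraMap k K γ * (expSeries χ - 1) by ring, map_mul, val_expSeries_sub_one k hχ]
  exact (mul_le_of_le_one_left' (val_algebraMap_le k γ)).trans_lt hχ

/-- The factorisation `α exp φ` of a unit is unique. -/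
theorem const_mul_expSeries_inj {φ ψ : K} {α β : k} (hα : α ≠ 0)
    (hφ : Valued.v φ < 1) (hψ : Valued.v ψ < 1)
    (h : algebraMap k K α * expSeries φ = algebraMap k K β * expSeries ψ) :
    α = β ∧ φ = ψ := by
  have hab : α = β := by 
    rw [← resid_const_mul_expSeries k (γ := α) hφ, h, resid_const_mul_expSeries k hψ]
  refine ⟨hab, ?_⟩
  subst hab
  have h1 := mul_left_cancel₀ (by simpa using hα) h
  have h2 := val_expSeries_sub k hφ hψ
  rw [h1, sub_self, map_zero] at h2
  exact sub_eq_zero.1 ((Valuation.zero_iff _).1 h2.symm)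

omit [CharZero k] in
/-- A limit of a sequence that converges at least geometrically. -/
theorem exists_limit_of_val_le {φ : ℕ → K}
    (h : ∀ n, Valued.v (φ (n + 1) - φ n) ≤ WithZero.exp (-(n : ℤ))) :
    ∃ x : K, ∀ n, Valued.v (x - φ n) ≤ WithZero.exp (-(n : ℤ)) := by
  refine ⟨φ 0 + ∑' n, (φ (n + 1) - φ n), fun n => ?_⟩
  have := val_tsum_sub_le k h n
  rw [Finset.sum_range_sub] at this
  rwa [show φ 0 + ∑' n, (φ (n + 1) - φ n) - φ n =
    ∑' n, (φ (n + 1) - φ n) - (φ n - φ 0) by ring]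

/-- The exponential maps `𝔭` onto `1 + 𝔭`, by successive approximation: `exp` being an isometry,
`φ + (u exp (-φ) - 1)` is a better approximation to the logarithm of `u` than `φ`. -/
theorem exists_expSeries_eq {u : K} (hu : Valued.v (u - 1) < 1) :
    ∃ φ : K, Valued.v φ < 1 ∧ expSeries φ = u := by
  let step : K → K := fun φ => φ + (u * expSeries (-φ) - 1)
  let φ : ℕ → K := fun n => step^[n] 0
  have hsucc : ∀ n, φ (n + 1) = φ n + (u * expSeries (-φ n) - 1) := fun n =>
    Function.iterate_succ_apply' step n 0
  have hu1 : Valued.v u = 1 := by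
    rw [show u = 1 + (u - 1) by ring, Valuation.map_add_eq_of_lt_left, map_one]
    rwa [map_one]
  have key : ∀ n : ℕ, Valued.v (φ n) < 1 ∧
      Valued.v (u * expSeries (-φ n) - 1) ≤ WithZero.exp (-(n + 1 : ℤ)) := by
    intro n
    induction n with
    | zero =>
      simp only [φ, Function.iterate_zero, id_eq, map_zero, neg_zero, expSeries_zero, mul_one]
      exact ⟨zero_lt_one, by simpa using val_le_exp_neg_one hu⟩
    | succ n ih =>
      obtain ⟨h1, h2⟩ := ih
      set ε := u * expSeries (-φ n) - 1 with hε
      have hε1 : Valued.v ε < 1 := h2.trans_lt (by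
        rw [← WithZero.exp_zero]; exact WithZero.exp_lt_exp.2 (by lia))
      have hs : φ (n + 1) = φ n + ε := hsucc n
      refine ⟨by rw [hs]; exact Valuation.map_add_lt _ h1 hε1, ?_⟩
      have hε1' : Valued.v (-ε) < 1 := by rwa [Valuation.map_neg]
      rw [hs, neg_add, expSeries_add k (by rwa [Valuation.map_neg]) hε1', ← mul_assoc,
        show u * expSeries (-φ n) = 1 + ε by rw [hε]; ring]
      -- `(1 + ε) exp (-ε) - 1 = (1 + ε) (exp (-ε) - (1 - ε)) - ε²`
      have hs := (hasSum_nat_add_iff' 2).2 (summable_expTerm k hε1').hasSum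
      have hb : Valued.v (expSeries (-ε) - (1 - ε)) ≤ WithZero.exp (-(n + 1 + 1 : ℤ)) := by
        have := val_hasSum_le k hs (n := -(n + 1 + 1 : ℤ)) (fun i => by
          rw [map_mul, map_inv₀, val_natCast k (Nat.factorial_ne_zero _), inv_one, one_mul,
            map_pow, Valuation.map_neg, pow_add, pow_two]
          calc _ ≤ 1 * (WithZero.exp (-(n + 1 : ℤ)) * WithZero.exp (-1 : ℤ)) := by
                gcongr
                · exact pow_le_one₀ zero_le hε1.le
                · exact val_le_exp_neg_one hε1
            _ = _ := by rw [one_mul, ← WithZero.exp_add]; congr 1)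
        have e : ∑ i ∈ Finset.range 2, (i.factorial : K)⁻¹ * (-ε) ^ i = 1 - ε := by
          simp [Finset.sum_range_succ]; ring
        rwa [e] at this
      have hsq : Valued.v (ε * ε) ≤ WithZero.exp (-(n + 1 + 1 : ℤ)) := by
        rw [map_mul]
        calc _ ≤ WithZero.exp (-(n + 1 : ℤ)) * WithZero.exp (-1 : ℤ) := by
              gcongr
              exact val_le_exp_neg_one hε1
          _ = _ := by rw [← WithZero.exp_add]; congr 1
      have e : (1 + ε) * expSeries (-ε) - 1 =
          (1 + ε) * (expSeries (-ε) - (1 - ε)) - ε * ε := by ring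
      push_cast
      rw [e]
      refine Valuation.map_sub_le _ ?_ hsq
      rw [map_mul]
      refine (mul_le_of_le_one_left' ?_).trans hb
      exact Valued.v.map_add_le (by simp) hε1.le
  obtain ⟨x, hx⟩ := exists_limit_of_val_le k (φ := φ) fun n => by
    rw [hsucc, add_sub_cancel_left]
    exact (key n).2.trans (WithZero.exp_le_exp.2 (by lia))
  have hx1 : Valued.v x < 1 := by
    rw [show x = (x - φ 1) + φ 1 by ring]
    exact Valuation.map_add_lt _ ((hx 1).trans_lt (by simpa using exp_neg_one_lt_one)) (key 1).1
  refine ⟨x, hx1, ?_⟩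
  rw [← sub_eq_zero]
  refine eq_zero_of_val_le fun n => ?_
  have hne := expSeries_ne_zero k (key n).1
  rw [show expSeries x - u = (expSeries x - expSeries (φ n)) -
    expSeries (φ n) * (u * expSeries (-φ n) - 1) by
      rw [expSeries_neg k (key n).1]; field_simp; ring]
  refine Valuation.map_sub_le _ ?_ ?_
  · rw [val_expSeries_sub k hx1 (key n).1]; exact hx n
  · rw [map_mul, val_expSeries k (key n).1, one_mul]
    exact (key n).2.trans (WithZero.exp_le_exp.2 (by lia))

theorem exists_unit_eq {u : K} (hu : Valued.v u = 1) :
    ∃ φ : K, Valued.v φ < 1 ∧ ∃ α : kˣ, u = algebraMap k K α * expSeries φ := by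
  have h := resid_spec (k := k) hu.le
  have h0 : resid k u ≠ 0 := by
    intro h'
    rw [h', map_zero, sub_zero, hu] at h
    exact lt_irrefl _ h
  have hα : algebraMap k K (resid k u) ≠ 0 := by simpa using h0
  obtain ⟨φ, hφ, he⟩ := exists_expSeries_eq k (u := u / algebraMap k K (resid k u)) (by
    rw [show u / algebraMap k K (resid k u) - 1 =
      (u - algebraMap k K (resid k u)) / algebraMap k K (resid k u) by field_simp,
      map_div₀, val_algebraMap _ h0, div_one]
    exact h)
  exact ⟨φ, hφ, Units.mk0 _ h0, by rw [he, Units.val_mk0]; field_simp⟩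

theorem expPart_eq {u φ : K} {α : k} (hα : α ≠ 0) (hφ : Valued.v φ < 1)
    (h : u = algebraMap k K α * expSeries φ) : expPart k u = φ := by
  have hex : ∃ φ : K, Valued.v φ < 1 ∧ ∃ α : k, u = algebraMap k K α * expSeries φ :=
    ⟨φ, hφ, α, h⟩
  rw [expPart, dif_pos hex]
  obtain ⟨h1, β, h2⟩ := hex.choose_spec
  exact (const_mul_expSeries_inj k hα hφ h1 (h.symm.trans h2)).2.symm

end LocalExp
end CompleteClosedField

/-! ### Residues, logarithmic differentials and adapted uniformizers -/

namespace CompleteClosedField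
noncomputable section LocalResidue

variable (k : Type*) {K : Type*} [Field k] [Field K] [Algebra k K] [Valued K ℤᵐ⁰]

theorem coeff_derivative {k : Type*} [Field k] (f : LaurentSeries k) (n : ℤ) :
    (LaurentSeries.derivative k f).coeff n = (n + 1 : ℤ) * f.coeff (n + 1) := by
  rw [LaurentSeries.derivative_apply, LaurentSeries.hasseDeriv_coeff, Nat.cast_one,
    Ring.choose_one_right, zsmul_eq_mul]

theorem coeff_X_mul_derivative {k : Type*} [Field k] (f : LaurentSeries k) (n : ℤ) :
    (HahnSeries.single 1 1 * LaurentSeries.derivative k f).coeff n = n * f.coeff n := by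
  rw [HahnSeries.coeff_single_mul, coeff_derivative, one_mul]
  simp

theorem derivative_mul {k : Type*} [Field k] (f g : LaurentSeries k) :
    LaurentSeries.derivative k (f * g) =
      f * LaurentSeries.derivative k g + g * LaurentSeries.derivative k f := by
  -- the Euler operator `X d/dX` multiplies coefficients by their index, so that it is enough to
  -- compare sums over one and the same antidiagonal
  have hX : (HahnSeries.single 1 1 : LaurentSeries k) ≠ 0 := by simp
  refine mul_left_cancel₀ hX ?_
  rw [mul_add, mul_left_comm, mul_left_comm _ g, mul_comm g]
  ext n
  have hsupp : ∀ h : LaurentSeries k,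
      (HahnSeries.single 1 1 * LaurentSeries.derivative k h).support ⊆ h.support := by
    intro h m hm
    rw [HahnSeries.mem_support, coeff_X_mul_derivative] at hm
    exact right_ne_zero_of_mul hm
  rw [coeff_X_mul_derivative, HahnSeries.coeff_add, HahnSeries.coeff_mul,
    HahnSeries.coeff_mul_right' g.isPWO_support (hsupp g),
    HahnSeries.coeff_mul_left' f.isPWO_support (hsupp f), Finset.mul_sum,
    ← Finset.sum_add_distrib]
  refine Finset.sum_congr rfl fun p hp => ?_
  rw [Finset.mem_antidiagonal] at hp
  rw [coeff_X_mul_derivative, coeff_X_mul_derivative, ← hp.2.2]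
  push_cast
  ring

variable [CompleteClosedField k K]

theorem coeff_expandInt (n : ℕ) (x : integers k K) :
    PowerSeries.coeff n (expandInt k K x) = coeffInt k n x := by
  simp [expandInt]

theorem expand_unif : expand k K (unif k K) = HahnSeries.single 1 1 := by
  have hv : Valued.v (unif k K) ≤ 1 := by rw [v_unif]; exact exp_neg_one_lt_one.le
  have h := expand_int k ⟨unif k K, mem_integers.2 hv⟩
  refine h.trans ?_
  have hX : expandInt k K ⟨unif k K, mem_integers.2 hv⟩ = PowerSeries.X := by
    obtain ⟨h0, h1⟩ := shift_unique k (x := ⟨unif k K, mem_integers.2 hv⟩) (y := 1) (a := 0)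
      (by simp)
    ext n
    rw [coeff_expandInt, PowerSeries.coeff_X]
    cases n with
    | zero => exact h0
    | succ n =>
      rw [coeffInt_succ, h1]
      have := coeffInt_algebraMap (K := K) k n 1
      rw [map_one] at this
      rw [this]; simp
  rw [hX]
  exact PowerSeries.coe_X (R := k)

theorem expand_unif_zpow (n : ℤ) :
    expand k K (unif k K ^ n) = HahnSeries.single n 1 := by
  rw [map_zpow₀, expand_unif]
  cases n with
  | ofNat n => rw [Int.ofNat_eq_natCast, zpow_natCast, HahnSeries.single_pow]; simp
  | negSucc n =>
    rw [zpow_negSucc, HahnSeries.single_pow, HahnSeries.inv_single, Int.negSucc_eq]; simp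

theorem coeff_expand_int {x : K} (hx : Valued.v x ≤ 1) {m : ℤ} (hm : m < 0) :
    (expand k K x).coeff m = 0 := by
  have h := expand_int k ⟨x, mem_integers.2 hx⟩
  simp only at h
  rw [h]
  exact (PowerSeries.coeff_coe _ m).trans (if_pos hm)

theorem coeff_expand_zero {x : K} (hx : Valued.v x ≤ 1) :
    (expand k K x).coeff 0 = resid k x := by
  have h := expand_int k ⟨x, mem_integers.2 hx⟩
  simp only at h
  rw [h]
  refine (PowerSeries.coeff_coe _ 0).trans ?_
  rw [if_neg (lt_irrefl _)]
  exact coeff_expandInt k 0 _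

theorem val_unif_zpow (n : ℤ) : Valued.v (unif k K ^ n) = WithZero.exp (-n) := by
  rw [map_zpow₀, v_unif, ← WithZero.exp_zsmul]; simp

/-- The Laurent expansion of an element of valuation at least `n` begins in degree `n`. -/
theorem coeff_expand_eq_zero {x : K} {n m : ℤ} (hx : Valued.v x ≤ WithZero.exp (-n))
    (hm : m < n) : (expand k K x).coeff m = 0 := by
  have hne := unif_ne_zero k (K := K)
  have h : x = unif k K ^ n * (unif k K ^ (-n) * x) := by
    rw [← mul_assoc, ← zpow_add₀ hne]; simp
  rw [h, map_mul, expand_unif_zpow, HahnSeries.coeff_single_mul, one_mul]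
  refine coeff_expand_int k ?_ (by lia)
  rw [map_mul, val_unif_zpow, neg_neg]
  calc _ ≤ WithZero.exp n * WithZero.exp (-n) := by gcongr
    _ = 1 := by rw [← WithZero.exp_add]; simp

theorem res_eq_zero_of_val {f g : K} {a b : ℤ} (hf : Valued.v f ≤ WithZero.exp (-a))
    (hg : Valued.v g ≤ WithZero.exp (-b)) (hab : 1 ≤ a + b) : res k f g = 0 := by
  rw [res, HahnSeries.coeff_mul]
  refine Finset.sum_eq_zero fun p hp => ?_
  rw [Finset.mem_antidiagonal] at hp
  by_cases h : p.1 < a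
  · rw [coeff_expand_eq_zero k hf h, zero_mul]
  · rw [coeff_derivative, coeff_expand_eq_zero k hg (by lia), mul_zero, mul_zero]

theorem res_mul_right (f g h : K) : res k f (g * h) = res k (f * g) h + res k (f * h) g := by
  simp only [res, map_mul, derivative_mul]
  rw [← HahnSeries.coeff_add]
  congr 1
  ring

theorem res_zero_left (g : K) : res k 0 g = 0 := by simp [res]

theorem res_zero_right (f : K) : res k f 0 = 0 := by simp [res]

theorem res_neg_left (f g : K) : res k (-f) g = -res k f g := by simp [res]

theorem res_sub_left (f f' g : K) : res k (f - f') g = res k f g - res k f' g := by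
  rw [sub_eq_add_neg, res_add_left, res_neg_left, sub_eq_add_neg]

theorem res_algebraMap_right (f : K) (a : k) : res k f (algebraMap k K a) = 0 := by
  have : LaurentSeries.derivative k (HahnSeries.C a : LaurentSeries k) = 0 := by
    ext n
    rw [coeff_derivative]
    by_cases h : n + 1 = 0
    · simp [h]
    · rw [HahnSeries.C_apply, HahnSeries.coeff_single_of_ne h]; simp
  rw [res, expand_algebraMap, this, mul_zero, HahnSeries.coeff_zero]

theorem res_sum_right {ι : Type*} (s : Finset ι) (f : K) (g : ι → K) :
    res k f (∑ i ∈ s, g i) = ∑ i ∈ s, res k f (g i) := by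
  classical
  induction s using Finset.induction_on with
  | empty => simp [res_zero_right]
  | insert i s hi ih => rw [Finset.sum_insert hi, Finset.sum_insert hi, res_add_right, ih]

theorem res_sum_left {ι : Type*} (s : Finset ι) (f : ι → K) (g : K) :
    res k (∑ i ∈ s, f i) g = ∑ i ∈ s, res k (f i) g := by
  classical
  induction s using Finset.induction_on with
  | empty => simp [res_zero_left]
  | insert i s hi ih => rw [Finset.sum_insert hi, Finset.sum_insert hi, res_add_left, ih]

theorem res_pow (f g : K) (n : ℕ) : res k f (g ^ (n + 1)) = (n + 1) * res k (f * g ^ n) g := by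
  induction n generalizing f with
  | zero => simp
  | succ n ih =>
    rw [pow_succ, res_mul_right, ih, show f * g * g ^ n = f * g ^ (n + 1) by ring]
    push_cast
    ring

theorem res_unif_zpow (m : ℤ) (j : ℕ) :
    res k (unif k K ^ (-m)) (unif k K ^ j) = if (j : ℤ) = m then (j : k) else 0 := by
  rw [← zpow_natCast, res, expand_unif_zpow, expand_unif_zpow, HahnSeries.coeff_single_mul,
    coeff_derivative, one_mul, show -1 - -m + 1 = m by ring, HahnSeries.coeff_single]
  split_ifs with h h1 h1
  · simp [h]
  · exact absurd h.symm h1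
  · exact absurd h1.symm h
  · simp

theorem resDlog_add_left (f f' a : K) : resDlog k (f + f') a = resDlog k f a + resDlog k f' a := by
  simp only [resDlog, add_mul, res_add_left]

theorem resDlog_smul_left (c : k) (f a : K) : resDlog k (c • f) a = c * resDlog k f a := by
  simp only [resDlog, smul_mul_assoc, res_smul_left]

theorem resDlog_mul (f : K) {a b : K} (ha : a ≠ 0) (hb : b ≠ 0) :
    resDlog k f (a * b) = resDlog k f a + resDlog k f b := by
  rw [resDlog, res_mul_right, resDlog, resDlog, add_comm]
  congr 2 <;> field_simp

theorem resDlog_one (f : K) : resDlog k f 1 = 0 := by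
  rw [resDlog, ← map_one (algebraMap k K), res_algebraMap_right]

/-- `a ↦ Res (f dlog a)` as a homomorphism `K^* → k`. -/
def resDlogHom (f : K) : Kˣ →* Multiplicative k where
  toFun a := Multiplicative.ofAdd (resDlog k f (a : K))
  map_one' := by rw [Units.val_one, resDlog_one, ofAdd_zero]
  map_mul' a b := by rw [Units.val_mul, resDlog_mul k f a.ne_zero b.ne_zero, ofAdd_add]

theorem resDlog_zpow (f : K) {a : K} (ha : a ≠ 0) (n : ℤ) :
    resDlog k f (a ^ n) = n * resDlog k f a := by
  have h := congrArg Multiplicative.toAdd (map_zpow (resDlogHom k f) (Units.mk0 a ha) n)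
  simpa [resDlogHom] using h

theorem resDlog_int {f u : K} (hf : Valued.v f ≤ 1) (hu : Valued.v u = 1) :
    resDlog k f u = 0 :=
  res_int k (by rwa [map_mul, map_inv₀, hu, inv_one, mul_one]) hu.le

theorem resDlog_eq_zero_of_val {f u : K} (hf : Valued.v f ≤ WithZero.exp (-1 : ℤ)) (hu : u ≠ 0) :
    resDlog k f u = 0 := by
  have hu' : Valued.v u ≠ 0 := by simpa using hu
  have h1 : Valued.v u = WithZero.exp (-(-WithZero.log (Valued.v u))) := by
    rw [neg_neg, WithZero.exp_log hu']
  refine res_eq_zero_of_val k (a := 1 + WithZero.log (Valued.v u)) ?_ h1.le (by lia)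
  rw [map_mul, map_inv₀]
  calc _ ≤ WithZero.exp (-1 : ℤ) * (Valued.v u)⁻¹ := by gcongr
    _ = WithZero.exp (-1 : ℤ) * (WithZero.exp (WithZero.log (Valued.v u)))⁻¹ := by
      rw [WithZero.exp_log hu']
    _ ≤ _ := by rw [← WithZero.exp_neg, ← WithZero.exp_add]; exact WithZero.exp_le_exp.2 (by lia)

theorem resDlog_unif {x : K} (hx : Valued.v x ≤ 1) : resDlog k x (unif k K) = resid k x := by
  have hd : LaurentSeries.derivative k (HahnSeries.single (1 : ℤ) (1 : k)) =
      HahnSeries.single 0 1 := by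
    rw [LaurentSeries.derivative_apply]
    simp
  rw [resDlog, res, map_mul, map_inv₀, expand_unif, hd, HahnSeries.coeff_mul_single_zero, mul_one,
    HahnSeries.inv_single, HahnSeries.coeff_mul_single, ← coeff_expand_zero k hx]
  simp

theorem resDlog_uniformizer {x t : K} (hx : Valued.v x ≤ 1)
    (ht : Valued.v t = WithZero.exp (-1 : ℤ)) : resDlog k x t = resid k x := by
  have hne := unif_ne_zero k (K := K)
  have ht0 : t ≠ 0 := by rintro rfl; rw [map_zero] at ht; exact WithZero.exp_ne_zero ht.symm
  have hu : Valued.v (t / unif k K) = 1 := by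
    rw [map_div₀, ht, v_unif, div_self WithZero.exp_ne_zero]
  rw [show t = unif k K * (t / unif k K) by field_simp,
    resDlog_mul k x hne (div_ne_zero ht0 hne), resDlog_int k hx hu, add_zero, resDlog_unif k hx]

variable [CharZero k]

/-- `dlog (exp φ) = dφ`, tested by residues. -/
theorem resDlog_expSeries (f : K) {φ : K} (hφ : Valued.v φ < 1) :
    resDlog k f (expSeries φ) = res k f φ := by
  have := charZero_of_const k K
  have hE := val_expSeries k hφ
  have hE0 := expSeries_ne_zero k hφ
  by_cases hf0 : f = 0
  · rw [hf0, resDlog, zero_mul, res_zero_left, res_zero_left]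
  have hf' : Valued.v f ≠ 0 := by simpa using hf0
  -- replace `exp φ` by a partial sum, up to an error that does not contribute to the residue
  set c := WithZero.log (Valued.v f) with hc
  have hvf : Valued.v f = WithZero.exp (-(-c)) := by rw [neg_neg, hc, WithZero.exp_log hf']
  set N := Int.toNat c + 1 with hN
  set S : ℕ → K := fun n => ∑ i ∈ Finset.range n, (i.factorial : K)⁻¹ * φ ^ i with hS
  set g := f * (expSeries φ)⁻¹ with hg
  have hvg : Valued.v g = WithZero.exp (-(-c)) := by
    rw [hg, map_mul, map_inv₀, hE, inv_one, mul_one, hvf]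
  have step : ∀ n, res k g (S (n + 1)) = res k (g * S n) φ := by
    intro n
    rw [hS]
    simp only
    rw [res_sum_right, Finset.sum_range_succ', Finset.mul_sum, res_sum_left]
    have h0 : res k g (((Nat.factorial 0 : ℕ) : K)⁻¹ * φ ^ 0) = 0 := by
      have := res_algebraMap_right k g 1
      simpa using this
    rw [h0, add_zero]
    refine Finset.sum_congr rfl fun i _ => ?_
    have e : ∀ (m : ℕ) (y : K), (m.factorial : K)⁻¹ * y = ((m.factorial : k)⁻¹) • y := by
      intro m y; rw [Algebra.smul_def, map_inv₀, map_natCast]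
    rw [e, e, res_smul_right, res_pow, mul_smul_comm, res_smul_left, Nat.factorial_succ]
    have : ((i : k) + 1) ≠ 0 := by exact_mod_cast Nat.succ_ne_zero i
    have h2 : (i.factorial : k) ≠ 0 := Nat.cast_ne_zero.2 (Nat.factorial_ne_zero i)
    push_cast
    field_simp
  have tail : ∀ n, Valued.v (expSeries φ - S n) ≤ WithZero.exp (-(n : ℤ)) :=
    val_expSeries_sub_le k hφ
  have h1 : res k g (expSeries φ) = res k g (S (N + 1)) := by
    rw [show expSeries φ = (expSeries φ - S (N + 1)) + S (N + 1) by ring, res_add_right,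
      res_eq_zero_of_val k hvg.le (tail (N + 1)) (by push_cast; lia), zero_add]
  have h2 : g * S N = f - g * (expSeries φ - S N) := by
    rw [hg]; field_simp; ring
  have h3 : res k (g * (expSeries φ - S N)) φ = 0 := by
    refine res_eq_zero_of_val k (a := -c + N) ?_ (val_le_exp_neg_one hφ) (by lia)
    rw [map_mul, neg_add, WithZero.exp_add]
    gcongr
    · exact hvg.le
    · exact tail N
  rw [resDlog, ← hg, h1, step, h2, res_sub_left, h3, sub_zero]

theorem resDlog_const_mul_expSeries (f : K) {φ : K} (hφ : Valued.v φ < 1) {α : k} (hα : α ≠ 0) :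
    resDlog k f (algebraMap k K α * expSeries φ) = res k f φ := by
  have hE0 := expSeries_ne_zero k hφ
  rw [resDlog_mul k f (by simpa using hα) hE0, resDlog_expSeries k f hφ, resDlog,
    res_algebraMap_right, zero_add]

omit [CharZero k] in
/-- A linear form on `K` that kills the integers and the negative powers of the uniformizer
vanishes: subtracting the leading term lowers the order of a pole. -/
theorem linearMap_eq_zero {L : K →ₗ[k] k} (h0 : ∀ x : K, Valued.v x ≤ 1 → L x = 0)
    (h1 : ∀ m : ℕ, L (unif k K ^ (-(m + 1 : ℤ))) = 0) : L = 0 := by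
  have key : ∀ (n : ℕ) (x : K), Valued.v x ≤ WithZero.exp (n : ℤ) → L x = 0 := by
    intro n
    induction n with
    | zero => intro x hx; exact h0 x (by simpa using hx)
    | succ n ih =>
      intro x hx
      have hne := unif_ne_zero k (K := K)
      have hy : Valued.v (x * unif k K ^ (n + 1 : ℤ)) ≤ 1 := by
        rw [map_mul, val_unif_zpow]
        calc _ ≤ WithZero.exp ((n + 1 : ℕ) : ℤ) * WithZero.exp (-(n + 1 : ℤ)) := by gcongr
          _ = 1 := by rw [← WithZero.exp_add]; simp
      have hr := val_le_exp_neg_one (resid_spec (k := k) hy)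
      set a := resid k (x * unif k K ^ (n + 1 : ℤ)) with ha
      have hx' : x = (x * unif k K ^ (n + 1 : ℤ) - algebraMap k K a) * unif k K ^ (-(n + 1 : ℤ)) +
          a • unif k K ^ (-(n + 1 : ℤ)) := by
        rw [Algebra.smul_def, sub_mul, mul_assoc, ← zpow_add₀ hne]; simp
      rw [hx', map_add, map_smul, h1, smul_zero, add_zero]
      refine ih _ ?_
      rw [map_mul, val_unif_zpow, neg_neg]
      calc _ ≤ WithZero.exp (-1 : ℤ) * WithZero.exp (n + 1 : ℤ) := by gcongr
        _ = _ := by rw [← WithZero.exp_add]; congr 1; ring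
  refine LinearMap.ext fun x => ?_
  by_cases hx : Valued.v x = 0
  · exact h0 x (by rw [hx]; exact zero_le)
  · refine key (Int.toNat (WithZero.log (Valued.v x))) x ?_
    rw [← WithZero.log_le_iff_le_exp hx]
    lia

/-- `Res (x dlog t)` as a `k`-linear form in `x`. -/
def resDlogLin (t : K) : K →ₗ[k] k where
  toFun x := resDlog k x t
  map_add' x y := resDlog_add_left k x y t
  map_smul' c x := resDlog_smul_left k c x t

/-- `Res (x dφ)` as a `k`-linear form in `x`. -/
def resLin (φ : K) : K →ₗ[k] k where
  toFun x := res k x φ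
  map_add' x y := res_add_left k x y φ
  map_smul' c x := res_smul_left k c x φ

omit [CharZero k] in
/-- Every sequence of coefficients is realised by an element of `𝔭`, and the coefficients are read
off by residues. -/
theorem exists_res_unif_zpow_eq (c : ℕ → k) : ∃ φ : K, Valued.v φ < 1 ∧
    ∀ m : ℕ, res k (unif k K ^ (-(m + 1 : ℤ))) φ = (m + 1) * c m := by
  let u : ℕ → K := fun n => c n • unif k K ^ (n + 1)
  have hu : ∀ n, Valued.v (u n) ≤ WithZero.exp (-(n + 1 : ℤ)) := by
    intro n
    simp only [u]
    rw [Algebra.smul_def, map_mul, ← zpow_natCast, val_unif_zpow]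
    push_cast
    exact mul_le_of_le_one_left' (val_algebraMap_le k _)
  have hu' : ∀ n, Valued.v (u n) ≤ WithZero.exp (-(n : ℤ)) := fun n =>
    (hu n).trans (WithZero.exp_le_exp.2 (by lia))
  refine ⟨∑' n, u n, ?_, fun m => ?_⟩
  · refine (val_hasSum_le k (summable_of_val_le k hu').hasSum (n := -1) fun i => ?_).trans_lt
      exp_neg_one_lt_one
    exact (hu i).trans (WithZero.exp_le_exp.2 (by lia))
  · have ht := val_tsum_sub_le k hu' (m + 2)
    rw [show ∑' n, u n = (∑' n, u n - ∑ n ∈ Finset.range (m + 2), u n) +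
      ∑ n ∈ Finset.range (m + 2), u n by ring, res_add_right,
      res_eq_zero_of_val k (val_unif_zpow k _).le ht (by push_cast; lia), zero_add, res_sum_right]
    have : ∀ n ∈ Finset.range (m + 2), res k (unif k K ^ (-(m + 1 : ℤ))) (u n) =
        if n = m then (m + 1) * c m else 0 := by
      intro n _
      rw [res_smul_right, res_unif_zpow]
      by_cases h : n = m
      · subst h; simp [mul_comm]
      · rw [if_neg (by push_cast; lia), if_neg h, mul_zero]
    rw [Finset.sum_congr rfl this, Finset.sum_ite_eq']
    simp

variable {k}

/-- For any complement `K₋` of the integers there is a uniformizer `t` such that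
`Res (y dlog t) = 0` for `y ∈ K₋`: multiplying a uniformizer by `exp φ` changes the form
`y ↦ Res (y dlog t)` on `K₋ ≃ K / 𝒪` by `y ↦ Res (y dφ)`, and in characteristic `0` every form on
`K / 𝒪` is of this kind. -/
theorem Splitting.exists_adapted (S : Splitting k K) :
    ∃ t : K, Valued.v t = WithZero.exp (-1 : ℤ) ∧ ∀ y ∈ S.neg, resDlog k y t = 0 := by
  -- the projection of `K` onto `K₋` along the integers
  let pr : K →ₗ[k] K := S.neg.subtype ∘ₗ S.neg.projectionOnto _ S.isCompl.symm
  have hpr_neg : ∀ y ∈ S.neg, pr y = y := fun y hy =>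
    congrArg Subtype.val (Submodule.projectionOnto_apply_left S.isCompl.symm ⟨y, hy⟩)
  have hpr_int : ∀ x : K, Valued.v x ≤ 1 → pr x = 0 := fun x hx =>
    congrArg Subtype.val
      (Submodule.projectionOnto_apply_right S.isCompl.symm ⟨x, (mem_integers (k := k)).2 hx⟩)
  have hpr_sub : ∀ x : K, Valued.v (x - pr x) ≤ 1 := by
    intro x
    obtain ⟨y, hy, z, hz, rfl⟩ := Submodule.mem_sup.1
      (S.isCompl.sup_eq_top.symm ▸ Submodule.mem_top : x ∈ _ ⊔ S.neg)
    rw [map_add, hpr_int y ((mem_integers (k := k)).1 hy), hpr_neg z hz, zero_add,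
      add_sub_cancel_right]
    exact (mem_integers (k := k)).1 hy
  -- the coefficients of `φ` are dictated by `Res (y dφ) = -Res (y dlog π)` on the projections `y`
  -- of the negative powers of the uniformizer `π`
  obtain ⟨φ, hφ, hres⟩ := exists_res_unif_zpow_eq (K := K) k fun m =>
    -((m : k) + 1)⁻¹ * resDlog k (pr (unif k K ^ (-(m + 1 : ℤ)))) (unif k K)
  have hE := val_expSeries k hφ
  have hE0 := expSeries_ne_zero k hφ
  let L : K →ₗ[k] k := (resDlogLin k (unif k K) + resLin k φ) ∘ₗ pr
  have hL : L = 0 := by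
    refine linearMap_eq_zero k (fun x hx => ?_) (fun m => ?_)
    · change (resDlogLin k (unif k K) + resLin k φ) (pr x) = 0
      rw [hpr_int x hx, map_zero]
    · have h1 : res k (pr (unif k K ^ (-(m + 1 : ℤ)))) φ =
          res k (unif k K ^ (-(m + 1 : ℤ))) φ := by
        rw [← sub_eq_zero, ← neg_eq_zero, neg_sub, ← res_sub_left]
        exact res_int k (hpr_sub _) hφ.le
      change resDlog k (pr _) _ + res k (pr _) φ = 0
      rw [h1, hres]
      have : ((m : k) + 1) ≠ 0 := by exact_mod_cast Nat.succ_ne_zero m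
      field_simp
      ring
  refine ⟨unif k K * expSeries φ, by rw [map_mul, hE, v_unif, mul_one], fun y hy => ?_⟩
  rw [resDlog_mul k y (unif_ne_zero k) hE0, resDlog_expSeries k y hφ]
  have := LinearMap.congr_fun hL y
  change resDlog k (pr y) _ + res k (pr y) φ = 0 at this
  rwa [hpr_neg y hy] at this

omit [CharZero k] in
/-- For an adapted uniformizer the constant term is `x(0) = Res (x dlog t)`. -/
theorem Splitting.resDlog_eq_constTerm (S : Splitting k K) {t : K}
    (ht : Valued.v t = WithZero.exp (-1 : ℤ)) (h : ∀ y ∈ S.neg, resDlog k y t = 0) (x : K) :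
    resDlog k x t = S.constTerm x := by
  obtain ⟨y, hy, z, hz, rfl⟩ := Submodule.mem_sup.1
    (S.isCompl.sup_eq_top.symm ▸ Submodule.mem_top : x ∈ _ ⊔ S.neg)
  rw [resDlog_add_left, h z hz, add_zero, resDlog_uniformizer k ((mem_integers (k := k)).1 hy) ht,
    Splitting.constTerm, map_add]
  congr 1
  have h1 := congrArg Subtype.val (Submodule.projectionOnto_apply_left S.isCompl ⟨y, hy⟩)
  have h2 := congrArg Subtype.val (Submodule.projectionOnto_apply_right S.isCompl ⟨z, hz⟩)
  simp only at h1 h2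
  rw [Submodule.coe_add, h1, h2]
  simp

end LocalResidue
end CompleteClosedField

/-! ### Local tame symbols and locally nilpotent exponentials -/

namespace CompleteClosedField
noncomputable section LocalTame

variable (k : Type*) {K : Type*} [Field k] [Field K] [Algebra k K] [Valued K ℤᵐ⁰]
  [CompleteClosedField k K]

theorem ord_eq_zero_iff {u : Kˣ} : ord (u : K) = 0 ↔ u ∈ unitGroup K := by
  rw [mem_unitGroup, val_eq_exp, ← WithZero.exp_zero, WithZero.exp_inj, neg_eq_zero]

theorem ord_zpow {t : Kˣ} (ht : Valued.v (t : K) = WithZero.exp (-1 : ℤ)) (n : ℤ) :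
    ord ((t ^ n : Kˣ) : K) = n := by
  rw [ord, Units.val_zpow_eq_zpow_val, map_zpow₀, ht, ← WithZero.exp_zsmul, WithZero.log_exp]
  simp

theorem residUnits_eq {u : unitGroup K} {α : kˣ}
    (h : Valued.v (((u : Kˣ) : K) - algebraMap k K α) < 1) : residUnits k K u = α :=
  Units.ext (resid_eq k h)

theorem tame_unit_left {u : Kˣ} (hu : u ∈ unitGroup K) (g : Kˣ) :
    tame k u g = residUnits k K ⟨u, hu⟩ ^ ord (g : K) := by
  rw [tame, ← map_zpow]
  congr 1
  apply Subtype.ext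
  change tameUnit u g = u ^ ord (g : K)
  simp [tameUnit, ord_eq_zero_iff.2 hu]

theorem tame_unit_right {u : Kˣ} (hu : u ∈ unitGroup K) (g : Kˣ) :
    tame k g u = residUnits k K ⟨u, hu⟩ ^ (-ord (g : K)) := by
  rw [tame, ← map_zpow]
  congr 1
  apply Subtype.ext
  change tameUnit g u = u ^ (-ord (g : K))
  simp [tameUnit, ord_eq_zero_iff.2 hu]

theorem tame_zpow_zpow {t : Kˣ} (ht : Valued.v (t : K) = WithZero.exp (-1 : ℤ)) (m n : ℤ) :
    tame k (t ^ m) (t ^ n) = (-1) ^ (m * n) := by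
  have hneg : (-1 : Kˣ) ∈ unitGroup K := mem_unitGroup.2 (by simp [Valuation.map_neg])
  have h : residUnits k K ⟨-1, hneg⟩ = -1 := residUnits_eq k (by simp)
  rw [tame, ← h, ← map_zpow]
  congr 1
  apply Subtype.ext
  change tameUnit (t ^ m) (t ^ n) = (-1 : Kˣ) ^ (m * n)
  rw [tameUnit, ord_zpow ht, ord_zpow ht, ← zpow_mul, ← zpow_mul, mul_comm n m, div_self', mul_one]

end LocalTame

section LocallyNilpotent

variable {k V : Type*} [Field k] [AddCommGroup V] [Module k V]

theorem pow_apply_eq_zero_of_le {T : Module.End k V} {v : V} {m n : ℕ} (h : (T ^ m) v = 0)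
    (hmn : m ≤ n) : (T ^ n) v = 0 := by
  rw [← Nat.sub_add_cancel hmn, pow_add, Module.End.mul_apply, h, map_zero]

theorem expEnd_apply {T : Module.End k V} (hT : ∀ v, ∃ n : ℕ, (T ^ n) v = 0) {v : V} {N : ℕ}
    (h : (T ^ N) v = 0) :
    expEnd T hT v = ∑ n ∈ Finset.range N, (n.factorial : k)⁻¹ • (T ^ n) v := by
  change ∑ᶠ n : ℕ, (n.factorial : k)⁻¹ • (T ^ n) v = _
  refine finsum_eq_sum_of_support_subset _ fun n hn => ?_
  by_contra hc
  rw [Finset.mem_coe, Finset.mem_range, not_lt] at hc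
  exact hn (by simp only [pow_apply_eq_zero_of_le h hc, smul_zero])

theorem expEnd_apply_of_apply_eq_zero {T : Module.End k V} (hT : ∀ v, ∃ n : ℕ, (T ^ n) v = 0)
    {v : V} (h : T v = 0) : expEnd T hT v = v := by
  rw [expEnd_apply hT (N := 1) (by simpa using h)]
  simp

variable [CharZero k]

/-- If `[T, A]` is the scalar `c`, then `exp T ∘ A = (A + c) ∘ exp T`. -/
theorem expEnd_comm_of_commutator {T A : Module.End k V} (hT : ∀ v, ∃ n : ℕ, (T ^ n) v = 0)
    {c : k} (h : ∀ v, T (A v) = A (T v) + c • v) (v : V) :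
    expEnd T hT (A v) = A (expEnd T hT v) + c • expEnd T hT v := by
  have hpow : ∀ n : ℕ, (T ^ (n + 1)) (A v) =
      A ((T ^ (n + 1)) v) + ((n + 1 : k) * c) • (T ^ n) v := by
    intro n
    induction n with
    | zero => simp [h]
    | succ n ih =>
      have hs : ∀ (m : ℕ) (w : V), T ((T ^ m) w) = (T ^ (m + 1)) w := fun m w => by
        rw [pow_succ', Module.End.mul_apply]
      rw [← hs, ih, map_add, h, map_smul, hs, hs, add_assoc, ← add_smul]
      push_cast
      congr 2
      ring
  obtain ⟨N₁, h₁⟩ := hT v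
  obtain ⟨N₂, h₂⟩ := hT (A v)
  have e₁ := pow_apply_eq_zero_of_le h₁ (Nat.le_add_right N₁ N₂)
  have e₂ := pow_apply_eq_zero_of_le h₂ (Nat.le_add_left N₂ N₁)
  set N := N₁ + N₂
  rw [expEnd_apply hT (pow_apply_eq_zero_of_le e₂ N.le_succ)]
  nth_rewrite 1 [expEnd_apply hT (pow_apply_eq_zero_of_le e₁ N.le_succ)]
  rw [expEnd_apply hT e₁, Finset.sum_range_succ', Finset.sum_range_succ', map_add, map_sum,
    Finset.smul_sum, add_right_comm, ← Finset.sum_add_distrib]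
  congr 1
  · refine Finset.sum_congr rfl fun n _ => ?_
    have h1 : ((n : k) + 1) ≠ 0 := by exact_mod_cast Nat.succ_ne_zero n
    have h2 : (n.factorial : k) ≠ 0 := Nat.cast_ne_zero.2 (Nat.factorial_ne_zero n)
    rw [hpow, smul_add, map_smul, smul_smul, smul_smul, Nat.factorial_succ]
    congr 2
    push_cast
    field_simp
  · simp

theorem expEnd_add_of_commute {T S : Module.End k V} (hT : ∀ v, ∃ n : ℕ, (T ^ n) v = 0)
    (hS : ∀ v, ∃ n : ℕ, (S ^ n) v = 0) (hTS : ∀ v, ∃ n : ℕ, ((T + S) ^ n) v = 0)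
    (hcomm : Commute T S) (v : V) :
    expEnd (T + S) hTS v = expEnd T hT (expEnd S hS v) := by
  obtain ⟨N₁, h₁⟩ := hT v
  obtain ⟨N₂, h₂⟩ := hS v
  obtain ⟨N₃, h₃⟩ := hTS v
  set N := N₁ + N₂ + N₃
  replace h₁ := pow_apply_eq_zero_of_le h₁ (show N₁ ≤ N by lia)
  replace h₂ := pow_apply_eq_zero_of_le h₂ (show N₂ ≤ N by lia)
  replace h₃ := pow_apply_eq_zero_of_le h₃ (show N₃ ≤ N + N by lia)
  have hexp : (T ^ N) (expEnd S hS v) = 0 := by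
    rw [expEnd_apply hS h₂, map_sum]
    refine Finset.sum_eq_zero fun n _ => ?_
    rw [map_smul, ← Module.End.mul_apply, (hcomm.pow_pow N n).eq, Module.End.mul_apply, h₁,
      map_zero, smul_zero]
  let g : ℕ × ℕ → V := fun p =>
    ((p.1.factorial : k)⁻¹ * (p.2.factorial : k)⁻¹) • (T ^ p.1) ((S ^ p.2) v)
  have hg : ∀ p : ℕ × ℕ, (N ≤ p.1 ∨ N ≤ p.2) → g p = 0 := by
    rintro ⟨i, j⟩ (h | h)
    · change _ • (T ^ i) ((S ^ j) v) = 0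
      rw [← Module.End.mul_apply, (hcomm.pow_pow i j).eq, Module.End.mul_apply,
        pow_apply_eq_zero_of_le h₁ h, map_zero, smul_zero]
    · change _ • (T ^ i) ((S ^ j) v) = 0
      rw [pow_apply_eq_zero_of_le h₂ h, map_zero, smul_zero]
  have hr : expEnd T hT (expEnd S hS v) = ∑ p ∈ Finset.range N ×ˢ Finset.range N, g p := by
    rw [expEnd_apply hT hexp, expEnd_apply hS h₂, Finset.sum_product]
    refine Finset.sum_congr rfl fun i _ => ?_
    rw [map_sum, Finset.smul_sum]
    refine Finset.sum_congr rfl fun j _ => ?_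
    rw [map_smul, smul_smul]
  rw [hr, expEnd_apply hTS h₃, ← Finset.sum_fiberwise_of_maps_to
    (t := Finset.range (N + N)) (g := fun p : ℕ × ℕ => p.1 + p.2) (fun p hp => by
      rw [Finset.mem_product, Finset.mem_range, Finset.mem_range] at hp
      rw [Finset.mem_range]; lia)]
  refine Finset.sum_congr rfl fun n _ => ?_
  rw [hcomm.add_pow', LinearMap.sum_apply, Finset.smul_sum]
  have hsub : ({p ∈ Finset.range N ×ˢ Finset.range N | p.1 + p.2 = n} : Finset (ℕ × ℕ)) ⊆
      Finset.HasAntidiagonal.antidiagonal n := fun p hp => by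
    rw [Finset.mem_filter] at hp
    exact Finset.HasAntidiagonal.mem_antidiagonal.2 hp.2
  rw [Finset.sum_subset hsub fun p hp hp' => ?_]
  · refine Finset.sum_congr rfl fun p hp => ?_
    rw [Finset.HasAntidiagonal.mem_antidiagonal] at hp
    have := inv_factorial_mul_choose hp (1 : k) 1
    simp only [one_pow, mul_one, nsmul_eq_mul] at this
    rw [LinearMap.smul_apply, ← Nat.cast_smul_eq_nsmul k, smul_smul, this]
    rfl
  · rw [Finset.HasAntidiagonal.mem_antidiagonal] at hp
    rw [Finset.mem_filter, Finset.mem_product, Finset.mem_range, Finset.mem_range] at hp'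
    exact hg p (by lia)

end LocallyNilpotent
end CompleteClosedField

/-! ### The adjoint action and the representation of the unit ideles -/

noncomputable section HeisenbergSystem

open HeisenbergAlgebra

variable {k F : Type*} [Field k] [IsAlgClosed k] [Field F] [Algebra k F]
  [IsCurveFunctionField k F]

theorem Idele.ext_comp {a b : Idele k F} (h : ∀ P, Idele.comp P a = Idele.comp P b) : a = b :=
  Units.ext (RestrictedProduct.ext _ _ fun P => congrArg Units.val (h P))

theorem Idele.div_apply (a : Idele k F) (P : CurvePoint k F) :
    Idele.div a P = ord (Idele.comp P a : P.LocalField) := rfl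

theorem Idele.div_mul (a b : Idele k F) : Idele.div (a * b) = Idele.div a + Idele.div b :=
  Finsupp.ext fun P => by
    rw [Finsupp.add_apply, div_apply, div_apply, div_apply, map_mul, ord_mul]

theorem Idele.div_inv (a : Idele k F) : Idele.div a⁻¹ = -Idele.div a := by
  have h1 : Idele.div (1 : Idele k F) = 0 := by
    have := Idele.div_mul (1 : Idele k F) 1
    rwa [one_mul, left_eq_add] at this
  rw [eq_neg_iff_add_eq_zero, ← Idele.div_mul, inv_mul_cancel, h1]

theorem mem_plusGroup {g : GlobalGroup k F} :
    g ∈ plusGroup k F ↔ ∀ P, Idele.comp P g.idele ∈ unitGroup P.LocalField := Iff.rfl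

theorem mem_plusGroup_iff_div {g : GlobalGroup k F} :
    g ∈ plusGroup k F ↔ Idele.div g.idele = 0 := by
  rw [mem_plusGroup, DFunLike.ext_iff]
  exact forall_congr' fun P => ord_eq_zero_iff.symm

theorem finite_resDlog (x : Adele k F) (a : Idele k F) :
    {P | resDlog k (x P) (Idele.comp P a : P.LocalField) ≠ 0}.Finite := by
  have h1 := x.2
  rw [Filter.eventually_cofinite] at h1
  refine (h1.union (Idele.finite_not_unit a)).subset fun P hP => ?_
  by_contra h
  simp only [Set.mem_union, Set.mem_ofPred_eq, not_or, not_not] at h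
  exact hP (resDlog_int k (mem_integers.1 h.1) (mem_unitGroup.1 h.2))

theorem resLog_add_left (x y : Adele k F) (a : Idele k F) :
    resLog (x + y) a = resLog x a + resLog y a := by
  have h := finsum_add_distrib (finite_resDlog x a) (finite_resDlog y a)
  simp only [resLog, RestrictedProduct.add_apply, resDlog_add_left]
  exact h

theorem resLog_smul_left (c : k) (x : Adele k F) (a : Idele k F) :
    resLog (c • x) a = c * resLog x a := by
  have h := smul_finsum' c (finite_resDlog x a)
  simp only [smul_eq_mul] at h
  simp only [resLog, RestrictedProduct.smul_apply, resDlog_smul_left]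
  exact h.symm

theorem resLog_mul (x : Adele k F) (a b : Idele k F) :
    resLog x (a * b) = resLog x a + resLog x b := by
  have h := finsum_add_distrib (finite_resDlog x a) (finite_resDlog x b)
  simp only [resLog, map_mul, Units.val_mul]
  rw [← h]
  exact finsum_congr fun P => resDlog_mul k (x P) (Units.ne_zero _) (Units.ne_zero _)

theorem resLog_one (x : Adele k F) : resLog x (1 : Idele k F) = 0 := by
  have h := resLog_mul x (1 : Idele k F) 1
  rwa [one_mul, left_eq_add] at h

theorem resLog_inv (x : Adele k F) (a : Idele k F) : resLog x a⁻¹ = -resLog x a := by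
  rw [eq_neg_iff_add_eq_zero, ← resLog_mul, inv_mul_cancel, resLog_one]

theorem fst_add_smul_C (x : HeisenbergAlgebra k F) (c : k) : (x + c • C k F).1 = x.1 := by
  change x.1 + c • (0 : Adele k F) = x.1
  rw [smul_zero, add_zero]

theorem Ad_mul (g h : GlobalGroup k F) (x : HeisenbergAlgebra k F) :
    Ad (g * h) x = Ad g (Ad h x) := by
  simp only [Ad, fst_add_smul_C, GlobalGroup.mul_def, resLog_mul, add_smul]
  abel

theorem Ad_add (g : GlobalGroup k F) (x y : HeisenbergAlgebra k F) :
    Ad g (x + y) = Ad g x + Ad g y := by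
  have : (x + y).1 = x.1 + y.1 := rfl
  simp only [Ad, this, resLog_add_left, add_smul]
  abel

theorem Ad_smul (g : GlobalGroup k F) (c : k) (x : HeisenbergAlgebra k F) :
    Ad g (c • x) = c • Ad g x := by
  have : (c • x).1 = c • x.1 := rfl
  simp only [Ad, this, resLog_smul_left, smul_add, smul_smul]

theorem Ad_C (g : GlobalGroup k F) : Ad g (C k F) = C k F := by
  have h : resLog (0 : Adele k F) g.idele = 0 := by
    have := resLog_smul_left (0 : k) (0 : Adele k F) g.idele
    rwa [zero_smul, zero_mul] at this
  change C k F + resLog (0 : Adele k F) g.idele • C k F = C k F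
  rw [h, zero_smul, add_zero]

variable [CharZero k]

theorem rho_Ad (g : GlobalGroup k F) (x : HeisenbergAlgebra k F) (v : FockSpace k F) :
    rho k F (Ad g x) v = rho k F x v + resLog x.1 g.idele • v := by
  rw [Ad, map_add, map_smul, LinearMap.add_apply, LinearMap.smul_apply, rho_C]

/-- Factorisation of the elements of `G_X⁺`: componentwise, units are constants times
exponentials. -/
theorem exists_plusGroup_eq (g : plusGroup k F) :
    ∃ (α : CurvePoint k F → kˣ) (φ : maximalAdeles k F), ∀ P,
      (Idele.comp P g.1.idele : P.LocalField) =
        algebraMap k _ (α P : k) * expSeries ((φ : Adele k F) P : P.LocalField) := by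
  choose φ hφ α h using fun P => exists_unit_eq k (mem_unitGroup.1 (g.2 P))
  exact ⟨α, ⟨⟨φ, .of_forall fun P => mem_integers.2 (hφ P).le⟩, hφ⟩, h⟩

theorem logAdele_eq {g : plusGroup k F} {α : CurvePoint k F → kˣ} {φ : maximalAdeles k F}
    (h : ∀ P, (Idele.comp P g.1.idele : P.LocalField) =
      algebraMap k _ (α P : k) * expSeries ((φ : Adele k F) P : P.LocalField)) :
    logAdele g = φ :=
  Subtype.ext (RestrictedProduct.ext _ _ fun P => expPart_eq k (α P).ne_zero (φ.2 P) (h P))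

theorem comp_eq_const_mul_exp (g : plusGroup k F) : ∃ α : CurvePoint k F → kˣ, ∀ P,
    (Idele.comp P g.1.idele : P.LocalField) =
      algebraMap k _ (α P : k) * expSeries ((logAdele g : Adele k F) P : P.LocalField) := by
  obtain ⟨α, φ, h⟩ := exists_plusGroup_eq g
  exact ⟨α, by rw [logAdele_eq h]; exact h⟩

omit [CharZero k] in
theorem mk_add_mk (x y : Adele k F) : mk x (0 : k) + mk y 0 = mk (x + y) 0 :=
  Prod.ext rfl (add_zero (0 : k))

theorem expRho_add {φ ψ χ : maximalAdeles k F} (h : (χ : Adele k F) = φ + ψ) :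
    expRho k F χ = expRho k F φ * expRho k F ψ := by
  ext v
  have hcomm : Commute (rho k F (mk (φ : Adele k F) 0)) (rho k F (mk (ψ : Adele k F) 0)) := by
    ext w
    rw [Module.End.mul_apply, Module.End.mul_apply, rho_comm]
    change _ + cocycle (φ : Adele k F) (ψ : Adele k F) • w = _
    rw [cocycle_integral (maximalAdeles_subset φ.2) (maximalAdeles_subset ψ.2), zero_smul,
      add_zero]
  have e : rho k F (mk (χ : Adele k F) 0) =
      rho k F (mk (φ : Adele k F) 0) + rho k F (mk (ψ : Adele k F) 0) := by
    rw [← map_add, mk_add_mk, h]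
  rw [Module.End.mul_apply, expRho, expRho, expRho, ← expEnd_add_of_commute _ _ ?_ hcomm]
  · simp only [e]
  · rw [← e]; exact rho_locally_nilpotent (maximalAdeles_subset χ.2)

theorem logAdele_mul (g h : plusGroup k F) :
    (logAdele (g * h) : Adele k F) = logAdele g + logAdele h := by
  obtain ⟨α, hα⟩ := comp_eq_const_mul_exp g
  obtain ⟨β, hβ⟩ := comp_eq_const_mul_exp h
  have hs : ((logAdele g : Adele k F) + logAdele h) ∈ maximalAdeles k F := fun P =>
    Valuation.map_add_lt _ ((logAdele g).2 P) ((logAdele h).2 P)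
  refine congrArg Subtype.val (logAdele_eq (φ := ⟨_, hs⟩) (α := α * β) fun P => ?_)
  have e : Idele.comp P (g * h).1.idele = Idele.comp P g.1.idele * Idele.comp P h.1.idele :=
    map_mul (Idele.comp P) g.1.idele h.1.idele
  rw [e, Units.val_mul, hα, hβ, Pi.mul_apply, Units.val_mul, map_mul]
  change _ = _ * expSeries ((logAdele g : Adele k F) P + (logAdele h : Adele k F) P)
  rw [expSeries_add k ((logAdele g).2 P) ((logAdele h).2 P)]
  ring

omit [CharZero k] in
theorem scalar_mul (g h : plusGroup k F) : (g * h).1.scalar = g.1.scalar * h.1.scalar := by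
  change (tameX g.1.idele h.1.idele)⁻¹ * g.1.scalar * h.1.scalar = _
  have : tameX g.1.idele h.1.idele = 1 := by
    rw [tameX]
    exact finprod_eq_one_of_forall_eq_one fun P => tame_unit k (g.2 P) (h.2 P)
  rw [this, inv_one, one_mul]

theorem rX_mul (g h : plusGroup k F) : rX (g * h) = rX g * rX h := by
  rw [rX, rX, rX, expRho_add (logAdele_mul g h), scalar_mul, smul_mul_smul_comm, Units.val_mul]

theorem expRho_apply_of_rho_eq_zero {φ : maximalAdeles k F} {v : FockSpace k F}
    (h : rho k F (mk (φ : Adele k F) 0) v = 0) : expRho k F φ v = v :=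
  expEnd_apply_of_apply_eq_zero _ h

theorem rho_mk_zero : rho k F (mk (0 : Adele k F) 0) = 0 :=
  map_zero (rho k F)

theorem rX_of_comp_eq_one {g : plusGroup k F} (h : g.1.idele = 1) :
    rX g = (g.1.scalar : k) • 1 := by
  have h0 : (0 : Adele k F) ∈ maximalAdeles k F := fun P => by
    rw [RestrictedProduct.zero_apply, map_zero]; exact zero_lt_one
  have hl : logAdele g = ⟨0, h0⟩ := logAdele_eq (α := 1) fun P => by
    rw [h, map_one, RestrictedProduct.zero_apply, expSeries_zero]; simp
  rw [rX, hl]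
  congr 1
  ext v
  exact expRho_apply_of_rho_eq_zero (by rw [rho_mk_zero]; rfl)

theorem rX_one : rX (1 : plusGroup k F) = 1 := by
  rw [rX_of_comp_eq_one rfl]
  exact one_smul k _

theorem rX_mul_inv_self (g : plusGroup k F) : rX g * rX g⁻¹ = 1 := by
  rw [← rX_mul, mul_inv_cancel, rX_one]

/-- The operators `r_X(g)` intertwine `ρ` and `ρ ∘ Ad g`. -/
theorem rX_rho (g : plusGroup k F) (x : HeisenbergAlgebra k F) (v : FockSpace k F) :
    rX g (rho k F x v) = rho k F (Ad g x) (rX g v) := by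
  obtain ⟨α, hα⟩ := comp_eq_const_mul_exp g
  have hlog : resLog x.1 g.1.idele = cocycle (logAdele g : Adele k F) x.1 := by
    rw [cocycle_skew, cocycle, neg_neg]
    refine finsum_congr fun P => ?_
    rw [hα, resDlog_const_mul_expSeries k _ ((logAdele g).2 P) (α P).ne_zero]
  have h := expEnd_comm_of_commutator
    (rho_locally_nilpotent (maximalAdeles_subset (logAdele g).2))
    (A := rho k F x) (rho_comm (mk (logAdele g : Adele k F) 0) x) v
  rw [rho_Ad, hlog, rX, LinearMap.smul_apply, LinearMap.smul_apply, map_smul,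
    smul_comm _ _ (_ : FockSpace k F), ← smul_add]
  exact congrArg _ h

end HeisenbergSystem

/-! ### The induced pair -/

noncomputable section InducedPair

open HeisenbergAlgebra

variable {k F : Type*} [Field k] [IsAlgClosed k] [Field F] [Algebra k F]
  [IsCurveFunctionField k F]

theorem adeleSub_mono {D E : CurveDivisor k F} (h : D ≤ E) : adeleSub D ⊆ adeleSub E :=
  fun _ hx P => (hx P).trans (WithZero.exp_le_exp.2 (h P))

theorem exists_divisor_forall_cocycle_eq_zero (x : Adele k F) :
    ∃ E : CurveDivisor k F, ∀ y ∈ adeleSub E, cocycle y x = 0 := by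
  classical
  have hx := x.2
  rw [Filter.eventually_cofinite] at hx
  refine ⟨Finsupp.ofSupportFinite
    (fun P => if Valued.v (x P) ≤ 1 then 0 else -(1 + WithZero.log (Valued.v (x P))))
    (hx.subset fun P hP h => hP (if_pos (mem_integers.1 h))), fun y hy => ?_⟩
  have h : ∀ P, res k (y P) (x P) = 0 := by
    intro P
    have hyP := hy P
    rw [Finsupp.ofSupportFinite_coe] at hyP
    split_ifs at hyP with hP
    · exact res_int k (by simpa using hyP) hP
    · have hne : Valued.v (x P) ≠ 0 := fun h0 => hP (by rw [h0]; exact zero_le)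
      refine res_eq_zero_of_val k hyP (b := -WithZero.log (Valued.v (x P))) ?_ (by lia)
      rw [neg_neg, WithZero.exp_log hne]
  simp [cocycle, h]

theorem exists_divisor_le_neg_one (b : Idele k F) :
    ∃ E : CurveDivisor k F, ∀ P, E P ≤ 0 ∧ (Idele.div b P ≠ 0 → E P ≤ -1) :=
  ⟨(Idele.div b).mapRange (fun n => -|n|) (by simp), fun P => by
    rw [Finsupp.mapRange_apply]
    exact ⟨by simp, fun h => by have := Int.one_le_abs h; lia⟩⟩

theorem resLog_eq_zero {x : Adele k F} {b : Idele k F} {E : CurveDivisor k F}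
    (hE : ∀ P, E P ≤ 0 ∧ (Idele.div b P ≠ 0 → E P ≤ -1)) (hx : x ∈ adeleSub E) :
    resLog x b = 0 := by
  refine finsum_eq_zero_of_forall_eq_zero fun P => ?_
  by_cases h : Idele.div b P = 0
  · refine resDlog_int k ((hx P).trans ?_) (mem_unitGroup.1 (ord_eq_zero_iff.1 h))
    rw [← WithZero.exp_zero]
    exact WithZero.exp_le_exp.2 (hE P).1
  · exact resDlog_eq_zero_of_val k ((hx P).trans (WithZero.exp_le_exp.2 ((hE P).2 h)))
      (Units.ne_zero _)

variable [CharZero k]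

/-- The action of the Heisenberg algebra on the Fock space is continuous: this holds at the vacuum,
and `ρ(x) ρ(y) v = ρ(y) ρ(x) v + c(x, y) v`, where `c(x, y) = 0` for `x` close to `0`. -/
theorem exists_divisor_forall_rho_eq_zero (v : FockSpace k F) :
    ∃ D : CurveDivisor k F, ∀ x ∈ adeleSub D, rho k F (mk x 0) v = 0 := by
  let p : Submodule k (FockSpace k F) :=
    { carrier := {v | ∃ D : CurveDivisor k F, ∀ x ∈ adeleSub D, rho k F (mk x 0) v = 0}
      zero_mem' := ⟨0, fun x _ => map_zero _⟩
      add_mem' := by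
        rintro v w ⟨D, hD⟩ ⟨E, hE⟩
        refine ⟨D ⊓ E, fun x hx => ?_⟩
        rw [map_add, hD x (adeleSub_mono inf_le_left hx), hE x (adeleSub_mono inf_le_right hx),
          add_zero]
      smul_mem' := by
        rintro a v ⟨D, hD⟩
        exact ⟨D, fun x hx => by rw [map_smul, hD x hx, smul_zero]⟩ }
  refine fock_induction (p := p) ⟨0, fun x hx => rho_vacuum fun P => ?_⟩ ?_ v
  · simpa using hx P
  · rintro y v ⟨D, hD⟩
    obtain ⟨E, hE⟩ := exists_divisor_forall_cocycle_eq_zero y.1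
    refine ⟨D ⊓ E, fun x hx => ?_⟩
    rw [rho_comm, hD x (adeleSub_mono inf_le_left hx), map_zero, zero_add]
    change cocycle x y.1 • v = 0
    rw [hE x (adeleSub_mono inf_le_right hx), zero_smul]

namespace inducedModule

theorem apply_mul (f : inducedModule k F) (g : GlobalGroup k F) (h : plusGroup k F) :
    f.1 (g * h) = rX h⁻¹ (f.1 g) := f.2.1 g h

theorem apply_mul_eq_zero_iff (f : inducedModule k F) (g : GlobalGroup k F) (h : plusGroup k F) :
    f.1 (g * h) = 0 ↔ f.1 g = 0 := by
  rw [apply_mul]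
  refine ⟨fun h0 => ?_, fun h0 => by rw [h0, map_zero]⟩
  have := congrArg (fun T : Module.End k (FockSpace k F) => T (f.1 g)) (rX_mul_inv_self h)
  simp only [Module.End.mul_apply, h0, map_zero] at this
  exact this.symm

/-- Finitely many points represent the cosets that meet the support. -/
theorem exists_finset_support (f : inducedModule k F) : ∃ s : Finset (GlobalGroup k F),
    ∀ h, f.1 h ≠ 0 → ∃ g ∈ s, ∃ p : plusGroup k F, h = g * p := by
  classical
  refine ⟨f.2.2.toFinset.image Quotient.out, fun h hh => ?_⟩
  refine ⟨Quotient.out (QuotientGroup.mk h : GlobalGroup k F ⧸ plusGroup k F),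
    Finset.mem_image_of_mem _ (f.2.2.mem_toFinset.2 ⟨h, hh, rfl⟩), ?_⟩
  obtain ⟨p, hp⟩ := QuotientGroup.mk_out_eq_mul (plusGroup k F) h
  refine ⟨p⁻¹, ?_⟩
  rw [hp, Subgroup.coe_inv, mul_inv_cancel_right]

variable (k F) in
/-- The action `(R_X(g) f)(h) = f(g⁻¹ h)`. -/
def groupAction : GlobalGroup k F →* Module.End k (inducedModule k F) where
  toFun g :=
    { toFun := fun f => ⟨fun h => f.1 (g⁻¹ * h), fun h p => by
        beta_reduce; rw [← mul_assoc, apply_mul], by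
        refine (f.2.2.image (g • ·)).subset ?_
        rintro _ ⟨h, hh, rfl⟩
        refine ⟨_, ⟨g⁻¹ * h, hh, rfl⟩, ?_⟩
        change (QuotientGroup.mk (g * (g⁻¹ * h)) : GlobalGroup k F ⧸ plusGroup k F) = _
        rw [mul_inv_cancel_left]⟩
      map_add' := fun _ _ => rfl
      map_smul' := fun _ _ => rfl }
  map_one' := by
    refine LinearMap.ext fun f => Subtype.ext (funext fun h => ?_)
    change f.1 (1⁻¹ * h) = f.1 h
    rw [inv_one, one_mul]
  map_mul' g g' := by
    refine LinearMap.ext fun f => Subtype.ext (funext fun h => ?_)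
    change f.1 ((g * g')⁻¹ * h) = f.1 (g'⁻¹ * (g⁻¹ * h))
    rw [mul_inv_rev, mul_assoc]

theorem groupAction_apply (g : GlobalGroup k F) (f : inducedModule k F) (h : GlobalGroup k F) :
    (groupAction k F g f).1 h = f.1 (g⁻¹ * h) := rfl

variable (k F) in
/-- The action `(dR_X(x) f)(g) = ρ(Ad g⁻¹ · x) (f(g))`. -/
def lieAction : HeisenbergAlgebra k F →ₗ[k] Module.End k (inducedModule k F) where
  toFun x :=
    { toFun := fun f => ⟨fun g => rho k F (Ad g⁻¹ x) (f.1 g), fun g h => by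
          beta_reduce; rw [apply_mul, mul_inv_rev, Ad_mul, rX_rho]; rfl,
        f.2.2.subset (Set.image_mono fun g hg h0 => hg (by
          change rho k F (Ad g⁻¹ x) (f.1 g) = 0
          rw [h0, map_zero]))⟩
      map_add' := fun f f' => Subtype.ext (funext fun g => map_add (rho k F (Ad g⁻¹ x)) _ _)
      map_smul' := fun c f => Subtype.ext (funext fun g => map_smul (rho k F (Ad g⁻¹ x)) c _) }
  map_add' x y := by
    refine LinearMap.ext fun f => Subtype.ext (funext fun g => ?_)
    change rho k F (Ad g⁻¹ (x + y)) (f.1 g) =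
      rho k F (Ad g⁻¹ x) (f.1 g) + rho k F (Ad g⁻¹ y) (f.1 g)
    rw [Ad_add, map_add, LinearMap.add_apply]
  map_smul' c x := by
    refine LinearMap.ext fun f => Subtype.ext (funext fun g => ?_)
    change rho k F (Ad g⁻¹ (c • x)) (f.1 g) = c • rho k F (Ad g⁻¹ x) (f.1 g)
    rw [Ad_smul, map_smul, LinearMap.smul_apply]

theorem lieAction_apply (x : HeisenbergAlgebra k F) (f : inducedModule k F)
    (g : GlobalGroup k F) : (lieAction k F x f).1 g = rho k F (Ad g⁻¹ x) (f.1 g) := rfl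

theorem lieAction_lie (x y : HeisenbergAlgebra k F) :
    lieAction k F ⁅x, y⁆ =
      lieAction k F x * lieAction k F y - lieAction k F y * lieAction k F x := by
  refine LinearMap.ext fun f => Subtype.ext (funext fun g => ?_)
  change rho k F (Ad g⁻¹ ⁅x, y⁆) (f.1 g) =
    rho k F (Ad g⁻¹ x) (rho k F (Ad g⁻¹ y) (f.1 g)) -
      rho k F (Ad g⁻¹ y) (rho k F (Ad g⁻¹ x) (f.1 g))
  rw [← rho_lie, lie_eq, lie_eq, Ad_smul, Ad_C, Ad, Ad, fst_add_smul_C, fst_add_smul_C]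

theorem lieAction_Ad (g : GlobalGroup k F) (x : HeisenbergAlgebra k F) :
    lieAction k F (Ad g x) = groupAction k F g * lieAction k F x * groupAction k F g⁻¹ := by
  refine LinearMap.ext fun f => Subtype.ext (funext fun h => ?_)
  change rho k F (Ad h⁻¹ (Ad g x)) (f.1 h) =
    rho k F (Ad (g⁻¹ * h)⁻¹ x) (f.1 (g⁻¹⁻¹ * (g⁻¹ * h)))
  rw [inv_inv, mul_inv_cancel_left, ← Ad_mul, mul_inv_rev, inv_inv]

theorem lieAction_C : lieAction k F (C k F) = 1 := by
  refine LinearMap.ext fun f => Subtype.ext (funext fun g => ?_)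
  change rho k F (Ad g⁻¹ (C k F)) (f.1 g) = f.1 g
  rw [Ad_C, rho_C]

omit [CharZero k] in
theorem tameX_one_left (b : Idele k F) : tameX 1 b = 1 := by
  have h := tameX_mul_left 1 1 b
  rwa [one_mul, left_eq_mul] at h

omit [CharZero k] in
theorem tameX_one_right (b : Idele k F) : tameX b 1 = 1 := by
  have h := tameX_mul_right b 1 1
  rwa [one_mul, left_eq_mul] at h

omit [CharZero k] in
theorem mk_comm_of_tameX_eq_one {a : Idele k F} {α : kˣ} {g : GlobalGroup k F}
    (h1 : tameX a g.idele = 1) (h2 : tameX g.idele a = 1) :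
    (⟨a, α⟩ : GlobalGroup k F) * g = g * ⟨a, α⟩ := by
  refine GlobalGroup.ext (mul_comm _ _) ?_
  change (tameX a g.idele)⁻¹ * α * g.scalar = (tameX g.idele a)⁻¹ * g.scalar * α
  rw [h1, h2, inv_one, one_mul, one_mul, mul_comm]

theorem groupAction_central (α : kˣ) : groupAction k F ⟨1, α⟩ = (α : k) • 1 := by
  refine LinearMap.ext fun f => Subtype.ext (funext fun h => ?_)
  have hmem : (⟨1, α⟩ : GlobalGroup k F) ∈ plusGroup k F := fun P => by
    rw [map_one]; exact one_mem _
  have hc : (⟨1, α⟩ : GlobalGroup k F)⁻¹ * h =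
      h * ((⟨⟨1, α⟩, hmem⟩ : plusGroup k F)⁻¹ : plusGroup k F) := by
    rw [inv_mul_eq_iff_eq_mul, ← mul_assoc,
      mk_comm_of_tameX_eq_one (tameX_one_left _) (tameX_one_right _), mul_assoc, Subgroup.coe_inv,
      mul_inv_cancel, mul_one]
  change f.1 (_ * h) = (α : k) • f.1 h
  rw [hc, apply_mul, inv_inv, rX_of_comp_eq_one rfl]
  rfl

theorem lieAction_continuous (f : inducedModule k F) :
    ∃ D : CurveDivisor k F, ∀ x ∈ adeleSub D, lieAction k F (mk x 0) f = 0 := by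
  classical
  obtain ⟨s, hs⟩ := exists_finset_support f
  choose D hD using fun g : GlobalGroup k F => exists_divisor_forall_rho_eq_zero (f.1 g)
  choose E hE using fun g : GlobalGroup k F => exists_divisor_le_neg_one g.idele
  obtain ⟨M, hM⟩ := (s.image fun g => D g ⊓ E g).bddBelow
  refine ⟨M, fun x hx => Subtype.ext (funext fun h => ?_)⟩
  by_cases hh : f.1 h = 0
  · rw [lieAction_apply, hh, map_zero]; rfl
  obtain ⟨g, hg, p, rfl⟩ := hs h hh
  have hMg := hM (Finset.mem_coe.2 (Finset.mem_image_of_mem _ hg))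
  refine (apply_mul_eq_zero_iff _ g p).2 ?_
  -- at the representative `g` both terms of `ρ(x) - ∑ Res (x dlog a)` vanish
  rw [lieAction_apply, rho_Ad, hD g x (adeleSub_mono (hMg.trans inf_le_left) hx), zero_add]
  change resLog x g.idele⁻¹ • _ = _
  rw [resLog_inv, resLog_eq_zero (hE g) (adeleSub_mono (hMg.trans inf_le_right) hx), neg_zero,
    zero_smul]

omit [CharZero k] in
/-- The tame symbol with a fixed idele is trivial on the ideles close to `1`. -/
theorem tameX_eq_one_of_close {a b : Idele k F} (ha : ∀ P, Idele.comp P a ∈ unitGroup P.LocalField)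
    (hab : ∀ P, Idele.div b P ≠ 0 → Valued.v ((a : Adele k F) P - 1) < 1) :
    tameX a b = 1 ∧ tameX b a = 1 := by
  have h : ∀ (P : CurvePoint k F) (e : ℤ), (Idele.div b P = 0 → e = 0) →
      residUnits k P.LocalField ⟨Idele.comp P a, ha P⟩ ^ e = 1 := by
    intro P e he
    by_cases hP : Idele.div b P = 0
    · rw [he hP, zpow_zero]
    · rw [residUnits_eq k (α := 1), one_zpow]
      rw [Units.val_one, map_one]
      exact hab P hP
  constructor
  · refine finprod_eq_one_of_forall_eq_one fun P => ?_
    rw [tame_unit_left k (ha P)]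
    exact h P _ id
  · refine finprod_eq_one_of_forall_eq_one fun P => ?_
    rw [tame_unit_right k (ha P)]
    exact h P _ fun h0 => neg_eq_zero.2 h0

theorem groupAction_continuous (f : inducedModule k F) :
    ∃ D : CurveDivisor k F, ∀ a : Idele k F, (a : Adele k F) - 1 ∈ adeleSub D →
      ((a⁻¹ : Idele k F) : Adele k F) - 1 ∈ adeleSub D → groupAction k F ⟨a, 1⟩ f = f := by
  classical
  obtain ⟨s, hs⟩ := exists_finset_support f
  choose D hD using fun g : GlobalGroup k F => exists_divisor_forall_rho_eq_zero (f.1 g)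
  choose E hE using fun g : GlobalGroup k F => exists_divisor_le_neg_one g.idele
  -- a divisor below `0` forces the ideles in question to be units everywhere
  obtain ⟨M, hM⟩ := (insert 0 (s.image fun g => D g ⊓ E g)).bddBelow
  have hM0 : M ≤ 0 := hM (Finset.mem_coe.2 (Finset.mem_insert_self _ _))
  refine ⟨M, fun a ha ha' => Subtype.ext (funext fun h => ?_)⟩
  have hint : ∀ {b : Idele k F}, (b : Adele k F) - 1 ∈ adeleSub M →
      ∀ P, Valued.v ((b : Adele k F) P) ≤ 1 := by
    intro b hb P
    have h1 : Valued.v ((b : Adele k F) P - 1) ≤ 1 := (hb P).trans (by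
      rw [← WithZero.exp_zero]; exact WithZero.exp_le_exp.2 (hM0 P))
    rw [show (b : Adele k F) P = ((b : Adele k F) P - 1) + 1 by ring]
    exact Valued.v.map_add_le h1 (by simp)
  have hunit : ∀ P, Idele.comp P a ∈ unitGroup P.LocalField := by
    intro P
    refine mem_unitGroup.2 (le_antisymm (hint ha P) ?_)
    have h4 : Valued.v (((Idele.comp P a)⁻¹ : P.LocalFieldˣ) : P.LocalField) ≤ 1 := by
      rw [← map_inv]; exact hint ha' P
    rw [Units.val_inv_eq_inv_val, map_inv₀] at h4
    exact (inv_le_one₀ (by simp [zero_lt_iff])).1 h4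
  set A : plusGroup k F := ⟨⟨a, 1⟩, hunit⟩ with hA
  rw [groupAction_apply]
  -- `(a, 1)` fixes all cosets, hence preserves the support of `f`
  by_cases hh : f.1 h = 0
  · have hmem : h⁻¹ * (A⁻¹ : plusGroup k F) * h ∈ plusGroup k F := by
      rw [mem_plusGroup]
      intro P
      have e : (h⁻¹ * (A⁻¹ : plusGroup k F) * h).idele = a⁻¹ := by
        change h.idele⁻¹ * a⁻¹ * h.idele = a⁻¹
        rw [mul_right_comm, inv_mul_cancel, one_mul]
      rw [e, map_inv]
      exact inv_mem (hunit P)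
    have := (apply_mul_eq_zero_iff f h ⟨_, hmem⟩).2 hh
    rw [hh]
    simpa [mul_assoc] using this
  obtain ⟨g, hg, p, rfl⟩ := hs h hh
  have hMg := hM (Finset.mem_coe.2 (Finset.mem_insert_of_mem (Finset.mem_image_of_mem _ hg)))
  have hlt : ∀ P, M P ≤ -1 → Valued.v ((a : Adele k F) P - 1) < 1 := fun P hP =>
    ((ha P).trans (WithZero.exp_le_exp.2 hP)).trans_lt exp_neg_one_lt_one
  obtain ⟨t1, t2⟩ := tameX_eq_one_of_close (b := g.idele) hunit fun P hP =>
    hlt P (((hMg.trans inf_le_right) P).trans ((hE g P).2 hP))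
  have hcomm : (⟨a, 1⟩ : GlobalGroup k F)⁻¹ * g = g * (A⁻¹ : plusGroup k F) := by
    rw [inv_mul_eq_iff_eq_mul, ← mul_assoc, mk_comm_of_tameX_eq_one t1 t2, mul_assoc]
    simp [hA]
  rw [← mul_assoc, apply_mul, hcomm, apply_mul, apply_mul, inv_inv]
  congr 1
  have hlog : (logAdele A : Adele k F) ∈ adeleSub M := by
    intro P
    obtain ⟨α, hα⟩ := comp_eq_const_mul_exp A
    have hφ := (logAdele A).2 P
    by_cases hP : M P = 0
    · rw [hP, WithZero.exp_zero]; exact hφ.le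
    -- where the divisor is negative, the constant is `1`, and `exp` is an isometry
    have h1 := hlt P (by have : M P ≤ 0 := hM0 P; lia)
    have h2 : ((a : Adele k F) P) = algebraMap k _ (α P : k) *
      expSeries ((logAdele A : Adele k F) P : P.LocalField) := hα P
    have hα1 : (α P : k) = 1 := by
      have e1 : resid k ((a : Adele k F) P) = 1 := resid_eq k (by simpa using h1)
      have e2 : resid k ((a : Adele k F) P) = α P := by
        rw [h2]; exact resid_const_mul_expSeries k hφ
      rw [← e2, e1]
    rw [hα1, map_one, one_mul] at h2
    rw [← val_expSeries_sub_one k hφ, ← h2]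
    exact ha P
  rw [rX]
  have h1 : ((A : GlobalGroup k F).scalar : k) = 1 := rfl
  rw [h1, one_smul]
  exact expRho_apply_of_rho_eq_zero (hD g _ (adeleSub_mono (hMg.trans inf_le_left) hlog))

theorem isHeisenbergSystemRep : IsHeisenbergSystemRep (groupAction k F) (lieAction k F) where
  lie := lieAction_lie
  compat := lieAction_Ad
  central_group := groupAction_central
  central_alg := lieAction_C
  continuous_group := groupAction_continuous
  continuous_alg := lieAction_continuous

end inducedModule
end InducedPair

/-! ### The extended charged Fock space -/

noncomputable section ChargedFock

open HeisenbergAlgebra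

variable {k F : Type*} [Field k] [IsAlgClosed k] [Field F] [Algebra k F]
  [IsCurveFunctionField k F]

theorem ne_zero_of_val_eq_exp {K : Type*} [Field K] [Valued K ℤᵐ⁰] {t : K} {n : ℤ}
    (ht : Valued.v t = WithZero.exp n) : t ≠ 0 := by
  rintro rfl
  rw [map_zero] at ht
  exact WithZero.exp_ne_zero ht.symm

section Uniformizers

variable {t : ∀ P : CurvePoint k F, P.LocalField}
  (ht : ∀ P, Valued.v (t P) = WithZero.exp (-1 : ℤ))

/-- The idele `{t_P ^ v_P(D)}` for a family of uniformizers `t_P`. -/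
def powIdele (D : CurveDivisor k F) : Idele k F where
  val := ⟨fun P => t P ^ D P, by
    refine D.hasFiniteSupport.subset fun P hP => ?_
    by_contra h
    exact hP (mem_integers.2 (by simp [show D P = 0 by simpa using h]))⟩
  inv := ⟨fun P => t P ^ (-D P), by
    refine D.hasFiniteSupport.subset fun P hP => ?_
    by_contra h
    exact hP (mem_integers.2 (by simp [show D P = 0 by simpa using h]))⟩
  val_inv := RestrictedProduct.ext _ _ fun P => by
    change t P ^ D P * t P ^ (-D P) = 1
    rw [← zpow_add₀ (ne_zero_of_val_eq_exp (ht P)), add_neg_cancel, zpow_zero]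
  inv_val := RestrictedProduct.ext _ _ fun P => by
    change t P ^ (-D P) * t P ^ D P = 1
    rw [← zpow_add₀ (ne_zero_of_val_eq_exp (ht P)), neg_add_cancel, zpow_zero]

theorem comp_powIdele_val (D : CurveDivisor k F) (P : CurvePoint k F) :
    (Idele.comp P (powIdele ht D) : P.LocalField) = t P ^ D P := rfl

theorem comp_powIdele (D : CurveDivisor k F) (P : CurvePoint k F) :
    Idele.comp P (powIdele ht D) = Units.mk0 (t P) (ne_zero_of_val_eq_exp (ht P)) ^ D P :=
  Units.ext (by rw [comp_powIdele_val, Units.val_zpow_eq_zpow_val, Units.val_mk0])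

theorem div_powIdele (D : CurveDivisor k F) : Idele.div (powIdele ht D) = D :=
  Finsupp.ext fun P => by
    rw [Idele.div_apply, comp_powIdele]
    exact ord_zpow (by exact ht P) _

theorem powIdele_add (D E : CurveDivisor k F) :
    powIdele ht (D + E) = powIdele ht D * powIdele ht E :=
  Idele.ext_comp fun P => by
    rw [map_mul, comp_powIdele, comp_powIdele, comp_powIdele, Finsupp.add_apply, zpow_add]

/-- The element `({t_P ^ v_P(D)}, 1)` of `G_X`, which represents the coset of `G_X⁺` given by the
divisor `D`. -/
def divisorSection (D : CurveDivisor k F) : GlobalGroup k F := ⟨powIdele ht D, 1⟩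

/-- The factor in `G_X⁺` of an element `g = ({t_P ^ v_P(D)}, 1) g₊` of `G_X`. -/
def plusPart (g : GlobalGroup k F) : plusGroup k F :=
  ⟨(divisorSection ht (Idele.div g.idele))⁻¹ * g, by
    rw [mem_plusGroup_iff_div]
    change Idele.div ((powIdele ht _)⁻¹ * g.idele) = 0
    rw [Idele.div_mul, Idele.div_inv, div_powIdele, neg_add_cancel]⟩

theorem divisorSection_mul_plusPart (g : GlobalGroup k F) :
    divisorSection ht (Idele.div g.idele) * (plusPart ht g : GlobalGroup k F) = g :=
  mul_inv_cancel_left _ _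

theorem div_divisorSection (D : CurveDivisor k F) :
    Idele.div (divisorSection ht D).idele = D := div_powIdele ht D

theorem div_mul_plus (g : GlobalGroup k F) (h : plusGroup k F) :
    Idele.div (g * (h : GlobalGroup k F)).idele = Idele.div g.idele := by
  change Idele.div (g.idele * h.1.idele) = _
  rw [Idele.div_mul, mem_plusGroup_iff_div.1 h.2, add_zero]

theorem plusPart_mul (g : GlobalGroup k F) (h : plusGroup k F) :
    plusPart ht (g * h) = plusPart ht g * h := by
  apply Subtype.ext
  change (divisorSection ht (Idele.div (g * (h : GlobalGroup k F)).idele))⁻¹ * (g * h) =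
    (divisorSection ht (Idele.div g.idele))⁻¹ * g * h
  rw [div_mul_plus, mul_assoc]

theorem plusPart_divisorSection (D : CurveDivisor k F) :
    plusPart ht (divisorSection ht D) = 1 := by
  apply Subtype.ext
  change (divisorSection ht (Idele.div (divisorSection ht D).idele))⁻¹ * divisorSection ht D = 1
  rw [div_divisorSection, inv_mul_cancel]

variable [CharZero k]

/-- Two elements of the induced module agree if they agree on representatives of the cosets. -/
theorem inducedModule.ext_divisorSection {f f' : inducedModule k F}
    (h : ∀ D, f.1 (divisorSection ht D) = f'.1 (divisorSection ht D)) : f = f' :=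
  Subtype.ext (funext fun g => by
    rw [← divisorSection_mul_plusPart ht g, inducedModule.apply_mul, inducedModule.apply_mul, h])

/-- An element of the induced module is determined by its values at representatives of the cosets,
which are arbitrary up to finiteness of the support. -/
def finsuppEquivInduced : (CurveDivisor k F →₀ FockSpace k F) ≃ₗ[k] inducedModule k F where
  toFun w := ⟨fun g => rX (plusPart ht g)⁻¹ (w (Idele.div g.idele)), fun g h => by
      beta_reduce
      rw [plusPart_mul, div_mul_plus, mul_inv_rev, rX_mul, Module.End.mul_apply], by
      refine ((w.hasFiniteSupport).image fun D =>
        (QuotientGroup.mk (divisorSection ht D) : GlobalGroup k F ⧸ plusGroup k F)).subset ?_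
      rintro _ ⟨g, hg, rfl⟩
      refine ⟨Idele.div g.idele, fun h0 => hg ?_, QuotientGroup.eq.2 (plusPart ht g).2⟩
      change rX (plusPart ht g)⁻¹ (w (Idele.div g.idele)) = 0
      rw [h0, map_zero]⟩
  map_add' w w' := Subtype.ext (funext fun g => map_add (rX (plusPart ht g)⁻¹) _ _)
  map_smul' c w := Subtype.ext (funext fun g => map_smul (rX (plusPart ht g)⁻¹) c _)
  invFun f := Finsupp.ofSupportFinite (fun D => f.1 (divisorSection ht D)) <| by
    refine Set.Finite.of_finite_image (f := fun D =>
      (QuotientGroup.mk (divisorSection ht D) : GlobalGroup k F ⧸ plusGroup k F))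
      (f.2.2.subset ?_) ?_
    · rintro _ ⟨D, hD, rfl⟩
      exact ⟨_, hD, rfl⟩
    · intro D _ E _ h
      have h1 : (divisorSection ht D)⁻¹ * divisorSection ht E ∈ plusGroup k F :=
        QuotientGroup.eq.1 h
      rw [mem_plusGroup_iff_div] at h1
      change Idele.div ((powIdele ht D)⁻¹ * powIdele ht E) = 0 at h1
      rw [Idele.div_mul, Idele.div_inv, div_powIdele, div_powIdele] at h1
      exact neg_add_eq_zero.1 h1
  left_inv w := Finsupp.ext fun D => by
    change rX (plusPart ht (divisorSection ht D))⁻¹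
      (w (Idele.div (divisorSection ht D).idele)) = w D
    rw [plusPart_divisorSection, div_divisorSection, inv_one, rX_one, Module.End.one_apply]
  right_inv f := inducedModule.ext_divisorSection ht fun D => by
    change rX (plusPart ht (divisorSection ht D))⁻¹
      (f.1 (divisorSection ht (Idele.div (divisorSection ht D).idele))) = _
    rw [plusPart_divisorSection, div_divisorSection, inv_one, rX_one, Module.End.one_apply]

open Classical in
/-- The isomorphism `ℬ̃_X ≃ Ind ℱ_X`, for a family of uniformizers. -/
def chargedEquiv : ChargedFockSpace k F ≃ₗ[k] inducedModule k F :=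
  (TensorProduct.congr (AddMonoidAlgebra.coeffLinearEquiv k) (LinearEquiv.refl k _)).trans
    ((TensorProduct.finsuppScalarLeft k (FockSpace k F) (CurveDivisor k F)).trans
      (finsuppEquivInduced ht))

open Classical in
theorem chargedEquiv_chargedVec (D : CurveDivisor k F) (v : FockSpace k F) :
    chargedEquiv ht (chargedVec D v) = finsuppEquivInduced ht (Finsupp.single D v) := by
  have h : TensorProduct.finsuppScalarLeft k (FockSpace k F) (CurveDivisor k F)
      (TensorProduct.tmul k (Finsupp.single D (1 : k)) v) = Finsupp.single D v := by
    rw [TensorProduct.finsuppScalarLeft_apply_tmul, Finsupp.sum_single_index (by simp), one_smul]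
  exact congrArg (finsuppEquivInduced ht) h

theorem chargedEquiv_apply (D : CurveDivisor k F) (v : FockSpace k F) (g : GlobalGroup k F) :
    (chargedEquiv ht (chargedVec D v)).1 g =
      rX (plusPart ht g)⁻¹ (Finsupp.single D v (Idele.div g.idele)) := by
  rw [chargedEquiv_chargedVec]; rfl

theorem chargedEquiv_apply_divisorSection (D E : CurveDivisor k F) (v : FockSpace k F) :
    (chargedEquiv ht (chargedVec D v)).1 (divisorSection ht E) = Finsupp.single D v E := by
  rw [chargedEquiv_apply, plusPart_divisorSection, div_divisorSection, inv_one, rX_one,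
    Module.End.one_apply]

theorem chargedEquiv_apply_eq_zero {D : CurveDivisor k F} (v : FockSpace k F)
    {g : GlobalGroup k F} (h : Idele.div g.idele ≠ D) :
    (chargedEquiv ht (chargedVec D v)).1 g = 0 := by
  rw [chargedEquiv_apply, Finsupp.single_eq_of_ne h, map_zero]

omit [CharZero k] in
theorem resLog_powIdele {S : ∀ P : CurvePoint k F, Splitting k P.LocalField}
    (hS : ∀ P, ∀ y ∈ (S P).neg, resDlog k y (t P) = 0) (x : Adele k F) (D : CurveDivisor k F) :
    resLog x (powIdele ht D) = evalDivisor S x D := by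
  rw [resLog, evalDivisor, Finsupp.sum]
  have h : ∀ P, resDlog k (x P) (Idele.comp P (powIdele ht D) : P.LocalField) =
      (D P : k) * (S P).constTerm (x P) := fun P => by
    rw [comp_powIdele_val, resDlog_zpow k _ (ne_zero_of_val_eq_exp (ht P)),
      (S P).resDlog_eq_constTerm (ht P) (hS P)]
  simp only [h]
  refine finsum_eq_sum_of_support_subset _ fun P hP => ?_
  rw [Finset.mem_coe, Finsupp.mem_support_iff]
  intro h0
  exact hP (by simp [h0])

theorem lieAction_chargedEquiv {S : ∀ P : CurvePoint k F, Splitting k P.LocalField}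
    (hS : ∀ P, ∀ y ∈ (S P).neg, resDlog k y (t P) = 0) (x : Adele k F) (γ : k)
    (D : CurveDivisor k F) (v : FockSpace k F) :
    inducedModule.lieAction k F (mk x γ) (chargedEquiv ht (chargedVec D v)) =
      chargedEquiv ht
        (-(evalDivisor S x D) • chargedVec D v + chargedVec D (rho k F (mk x γ) v)) := by
  classical
  refine inducedModule.ext_divisorSection ht fun E => ?_
  rw [inducedModule.lieAction_apply, map_add, map_smul]
  change _ = -(evalDivisor S x D) • (chargedEquiv ht (chargedVec D v)).1 (divisorSection ht E) +
    (chargedEquiv ht (chargedVec D _)).1 (divisorSection ht E)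
  rw [chargedEquiv_apply_divisorSection, chargedEquiv_apply_divisorSection, rho_Ad]
  by_cases h : E = D
  · subst h
    rw [Finsupp.single_eq_same, Finsupp.single_eq_same, add_comm]
    congr 2
    change resLog x (powIdele ht E)⁻¹ = _
    rw [resLog_inv, resLog_powIdele ht hS]
  · rw [Finsupp.single_eq_of_ne h, Finsupp.single_eq_of_ne h]
    simp

omit [CharZero k] in
/-- The scalar `β` in `(a, 1) s(D) = s(D + E) (u, β)`, where `a = t ^ E u` with a unit idele `u` and
`s(D) = (t ^ D, 1)`. -/
theorem tameX_powIdele {u : Idele k F} {α : CurvePoint k F → kˣ}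
    (hu : ∀ P, Idele.comp P u ∈ unitGroup P.LocalField)
    (hα : ∀ P, residUnits k P.LocalField ⟨Idele.comp P u, hu P⟩ = α P)
    (D E : CurveDivisor k F) :
    (tameX (powIdele ht E * u) (powIdele ht D))⁻¹ * tameX (powIdele ht (D + E)) u =
      (-1) ^ (D.sum fun P n => n * E P) * ∏ᶠ P, α P ^ (-E P - 2 * D P) := by
  classical
  have hsign : ((-1) ^ (D.sum fun P n => n * E P) : kˣ) = ∏ᶠ P, (-1) ^ (D P * E P) := by
    have hs : ∀ s : Finset (CurvePoint k F),
        ((-1) ^ (∑ P ∈ s, D P * E P) : kˣ) = ∏ P ∈ s, (-1) ^ (D P * E P) := fun s => by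
      induction s using Finset.induction_on with
      | empty => simp
      | insert P s hP ih => rw [Finset.sum_insert hP, Finset.prod_insert hP, zpow_add, ih]
    rw [Finsupp.sum, hs]
    symm
    refine finprod_eq_prod_of_mulSupport_subset _ fun P hP => ?_
    rw [Finset.mem_coe, Finsupp.mem_support_iff]
    intro h0
    exact hP (by simp [h0])
  have hf3 : Function.HasFiniteMulSupport fun P =>
      (tame k (Idele.comp P (powIdele ht E * u)) (Idele.comp P (powIdele ht D)))⁻¹ :=
    (finite_tame (powIdele ht E * u) (powIdele ht D)).subset fun P hP h0 => hP (inv_eq_one.2 h0)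
  have hf4 : Function.HasFiniteMulSupport fun P =>
      tame k (Idele.comp P (powIdele ht (D + E))) (Idele.comp P u) := finite_tame _ _
  have hf1 : (Function.mulSupport fun P => ((-1) ^ (D P * E P) : kˣ)).Finite := by
    refine D.hasFiniteSupport.subset fun P hP h0 => hP ?_
    simp [show D P = 0 from h0]
  have hf2 : (Function.mulSupport fun P => α P ^ (-E P - 2 * D P)).Finite := by
    refine (D.hasFiniteSupport.union E.hasFiniteSupport).subset fun P hP => ?_
    by_contra h0
    simp only [Set.mem_union, Function.mem_support, not_or, not_not] at h0
    exact hP (by simp [h0.1, h0.2])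
  rw [hsign, ← finprod_mul_distrib hf1 hf2, tameX, tameX, ← finprod_inv_distrib,
    ← finprod_mul_distrib hf3 hf4]
  refine finprod_congr fun P => ?_
  have ht' : Valued.v ((Units.mk0 (t P) (ne_zero_of_val_eq_exp (ht P)) : P.LocalFieldˣ) :
    P.LocalField) = WithZero.exp (-1 : ℤ) := ht P
  rw [map_mul, tame_mul_left, comp_powIdele, comp_powIdele, comp_powIdele, tame_zpow_zpow k ht',
    tame_unit_left k (hu P), tame_unit_right k (hu P), hα, ord_zpow ht', ord_zpow ht', mul_inv,
    ← inv_zpow, inv_neg_one, mul_assoc, ← zpow_neg, ← zpow_add, Finsupp.add_apply,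
    mul_comm (E P) (D P)]
  congr 2
  ring

theorem groupAction_chargedEquiv {a : Idele k F} {α : CurvePoint k F → kˣ}
    {φ : maximalAdeles k F}
    (h : ∀ P, (Idele.comp P a : P.LocalField) = algebraMap k _ (α P : k) *
      t P ^ Idele.div a P * expSeries ((φ : Adele k F) P : P.LocalField))
    (D : CurveDivisor k F) (v : FockSpace k F) :
    inducedModule.groupAction k F ⟨a, 1⟩ (chargedEquiv ht (chargedVec D v)) =
      chargedEquiv ht ((((-1) ^ (D.sum fun P n => n * Idele.div a P) *
        ∏ᶠ P, α P ^ (-(Idele.div a P) - 2 * D P) : kˣ) : k) •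
          chargedVec (D + Idele.div a) (expRho k F φ v)) := by
  -- the unit part `{α_P exp φ_P}` of the idele `a`
  set u : Idele k F := (powIdele ht (Idele.div a))⁻¹ * a with hu_def
  have ha : a = powIdele ht (Idele.div a) * u := (mul_inv_cancel_left _ _).symm
  have hdivu : Idele.div u = 0 := by
    rw [hu_def, Idele.div_mul, Idele.div_inv, div_powIdele, neg_add_cancel]
  have hu : ∀ P, Idele.comp P u ∈ unitGroup P.LocalField := fun P =>
    ord_eq_zero_iff.1 (DFunLike.congr_fun hdivu P)
  have hcomp : ∀ P, (Idele.comp P u : P.LocalField) =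
      algebraMap k _ (α P : k) * expSeries ((φ : Adele k F) P : P.LocalField) := fun P => by
    have hne : t P ^ Idele.div a P ≠ 0 := zpow_ne_zero _ (ne_zero_of_val_eq_exp (ht P))
    rw [hu_def, map_mul, map_inv, Units.val_mul, h, Units.val_inv_eq_inv_val, comp_powIdele_val]
    field_simp
  have hα : ∀ P, residUnits k P.LocalField ⟨Idele.comp P u, hu P⟩ = α P := fun P =>
    Units.ext ((congrArg (resid k) (hcomp P)).trans (resid_const_mul_expSeries k (φ.2 P)))
  set β : kˣ := (-1) ^ (D.sum fun P n => n * Idele.div a P) *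
    ∏ᶠ P, α P ^ (-(Idele.div a P) - 2 * D P) with hβ
  have hβ' : (tameX a (powIdele ht D))⁻¹ * tameX (powIdele ht (D + Idele.div a)) u = β := by
    have := tameX_powIdele ht hu hα D (Idele.div a)
    rwa [← ha] at this
  let q : plusGroup k F := ⟨⟨u, β⟩, hu⟩
  -- `(a, 1)` permutes the cosets, up to the scalar computed above
  have hmul : (⟨a, 1⟩ : GlobalGroup k F) * divisorSection ht D =
      divisorSection ht (D + Idele.div a) * (q : GlobalGroup k F) := by
    refine GlobalGroup.ext ?_ ?_
    · change a * powIdele ht D = powIdele ht (D + Idele.div a) * u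
      nth_rewrite 1 [ha]
      rw [powIdele_add]
      ac_rfl
    · change (tameX a (powIdele ht D))⁻¹ * 1 * 1 =
        (tameX (powIdele ht (D + Idele.div a)) u)⁻¹ * 1 * β
      rw [← hβ']
      simp only [mul_one]
      rw [mul_left_comm, inv_mul_cancel, mul_one]
  refine inducedModule.ext_divisorSection ht fun E => ?_
  rw [map_smul]
  change (chargedEquiv ht (chargedVec D v)).1 ((⟨a, 1⟩ : GlobalGroup k F)⁻¹ * divisorSection ht E) =
    (β : k) • (chargedEquiv ht (chargedVec _ _)).1 (divisorSection ht E)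
  rw [chargedEquiv_apply_divisorSection]
  by_cases hE : E = D + Idele.div a
  · subst hE
    have e : (⟨a, 1⟩ : GlobalGroup k F)⁻¹ * divisorSection ht (D + Idele.div a) =
        divisorSection ht D * ((q⁻¹ : plusGroup k F) : GlobalGroup k F) := by
      rw [inv_mul_eq_iff_eq_mul, ← mul_assoc, hmul, mul_assoc, Subgroup.coe_inv, mul_inv_cancel,
        mul_one]
    rw [e, inducedModule.apply_mul, inv_inv, chargedEquiv_apply_divisorSection,
      Finsupp.single_eq_same, Finsupp.single_eq_same, rX, logAdele_eq (g := q) hcomp]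
    rfl
  · rw [Finsupp.single_eq_of_ne hE, smul_zero]
    refine chargedEquiv_apply_eq_zero ht v fun h0 => hE ?_
    change Idele.div (a⁻¹ * powIdele ht E) = D at h0
    rw [Idele.div_mul, Idele.div_inv, div_powIdele] at h0
    rw [← h0]
    abel

end Uniformizers
end ChargedFock

theorem mainTheorem10 {k F : Type*} [Field k] [IsAlgClosed k] [CharZero k] [Field F]
    [Algebra k F] [IsCurveFunctionField k F] :
    -- every element of `G_X⁺` has the form `({α_P exp φ_P}, β)`, and `r_X = β exp ρ(φ)` is a
    -- well-defined representation of `G_X⁺`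
    (∀ g : plusGroup k F, ∃ (α : CurvePoint k F → kˣ) (φ : maximalAdeles k F), ∀ P,
      (Idele.comp P g.1.idele : P.LocalField) =
        algebraMap k _ (α P : k) * expSeries ((φ : Adele k F) P : P.LocalField)) ∧
    (∀ (g : plusGroup k F) (α : CurvePoint k F → kˣ) (φ : maximalAdeles k F),
      (∀ P, (Idele.comp P g.1.idele : P.LocalField) =
        algebraMap k _ (α P : k) * expSeries ((φ : Adele k F) P : P.LocalField)) →
        rX g = (g.1.scalar : k) • expRho k F φ) ∧
    (rX (1 : plusGroup k F) = 1 ∧ ∀ g h : plusGroup k F, rX (g * h) = rX g * rX h) ∧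
    -- the induced pair `(R_X, dR_X)` is a representation of the global Heisenberg system
    ∃ (R : GlobalGroup k F →* Module.End k (inducedModule k F))
      (dR : HeisenbergAlgebra k F →ₗ[k] Module.End k (inducedModule k F)),
      (∀ g f h, (R g f : GlobalGroup k F → FockSpace k F) h =
        (f : GlobalGroup k F → FockSpace k F) (g⁻¹ * h)) ∧
      (∀ x f g, (dR x f : GlobalGroup k F → FockSpace k F) g =
        rho k F (Ad g⁻¹ x) ((f : GlobalGroup k F → FockSpace k F) g)) ∧
      IsHeisenbergSystemRep R dR ∧
      -- the induced module is isomorphic to the extended charged Fock space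
      ∀ S : (∀ P : CurvePoint k F, Splitting k P.LocalField),
        (∃ t, IsAdapted S t) ∧ ∀ t, IsAdapted S t →
          ∃ Φ : ChargedFockSpace k F ≃ₗ[k] inducedModule k F,
            (∀ D v g, (Φ (chargedVec D v) : GlobalGroup k F → FockSpace k F) g ≠ 0 →
              Idele.div g.idele = D) ∧
            (∀ D v (a : Idele k F), (∀ P, (Idele.comp P a : P.LocalField) = t P ^ D P) →
              (Φ (chargedVec D v) : GlobalGroup k F → FockSpace k F) ⟨a, 1⟩ = v) ∧
            (∀ x γ D v, dR (HeisenbergAlgebra.mk x γ) (Φ (chargedVec D v)) =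
              Φ (-(evalDivisor S x D) • chargedVec D v +
                chargedVec D (rho k F (HeisenbergAlgebra.mk x γ) v))) ∧
            (∀ (a : Idele k F) (α : CurvePoint k F → kˣ) (φ : maximalAdeles k F),
              (∀ P, (Idele.comp P a : P.LocalField) = algebraMap k _ (α P : k) *
                t P ^ Idele.div a P *
                  expSeries ((φ : Adele k F) P : P.LocalField)) →
              ∀ D v, R ⟨a, 1⟩ (Φ (chargedVec D v)) =
                Φ ((((-1) ^ (D.sum fun P n => n * Idele.div a P) *
                    ∏ᶠ P, α P ^ (-(Idele.div a P) - 2 * D P) : kˣ) : k) •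
                  chargedVec (D + Idele.div a) (expRho k F φ v))) := by
  refine ⟨exists_plusGroup_eq, fun g α φ h => by rw [rX, logAdele_eq h], ⟨rX_one, rX_mul⟩,
    inducedModule.groupAction k F, inducedModule.lieAction k F, inducedModule.groupAction_apply,
    inducedModule.lieAction_apply, inducedModule.isHeisenbergSystemRep, fun S => ⟨?_, ?_⟩⟩
  · choose t ht hS using fun P => (S P).exists_adapted
    exact ⟨t, ht, hS⟩
  · rintro t ⟨ht, hS⟩
    refine ⟨chargedEquiv ht, fun D v g hg => ?_, fun D v a ha => ?_,
      lieAction_chargedEquiv ht hS, fun a α φ h D v => groupAction_chargedEquiv ht h D v⟩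
    · by_contra hne
      exact hg (chargedEquiv_apply_eq_zero ht v hne)
    · have e : (⟨a, 1⟩ : GlobalGroup k F) = divisorSection ht D :=
        GlobalGroup.ext (Idele.ext_comp fun P => Units.ext (ha P)) rfl
      rw [e, chargedEquiv_apply_divisorSection, Finsupp.single_eq_same]
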